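/- Let $T_3$ be the tree all of whose vertices have valency $3$. A function $\phi$ from the vertices of a graph to $\mathbb C$ is harmonic if $\frac1{\nu(x)}\sum_{y\sim x}\phi(y)-\phi(x)=0$ at every vertex $x$ of valency $\nu(x)$, and holomorphic if $\phi$ and $\phi^2$ are harmonic. Let $Hol^*(T_3)$ be the space of non-constant holomorphic functions on $T_3$; for adjacent vertices $a,b$ and $\alpha\ne\beta$ in $\mathbb C$, let $\mathcal H_{\alpha,\beta}(T_3)$ be the space of holomorphic $\phi$ with $\phi(a)=\alpha$, $\phi(b)=\beta$. Let $SG$ be the group of similarities $z\mapsto\theta z+t$ ($\theta,t\in\mathbb C$, $\theta\neq0$), and let $H\subset Aut(T_3)$ be the subgroup fixing both $a$ and $b$. Groups of automorphisms act on functions by $\gamma\cdot\phi=\phi\circ\gamma^{-1}$, and $SG$ by $s\cdot\phi=s\circ\phi$. Function spaces and $Aut(T_3)$ carry the topology of pointwise convergence (the vertex set being discrete), $SG$ the topology of the coordinates $(\theta,t)$. With $w=\beta-\alpha$ and $j=e^{2\pi i/3}$, let $\tau_{\alpha,\beta}$ be the tiling of $\mathbb C$ generated, by repeated reflections in the edges,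 from the regular hexagon with successive vertices $\alpha,\ \alpha+w,\ \alpha+w-jw,\ \alpha+w-jw+j^2w,\ \alpha+w-jw+j^2w-w,\ \alpha+w-jw+j^2w-w+jw$; it is also regarded as a graph (its vertices and edges). Let $\phi\in Hol^*(T_3)$. 1. For any adjacent $a,b$ one has $\phi(a)\neq\phi(b)$, and $\phi$ maps the vertices of $T_3$ onto the vertices of the hexagonal tiling $\tau=\tau_{\phi(a),\phi(b)}$. 2. In fact $\phi:T_3\to\tau$ is the universal covering of the graph $\tau$ (a surjective graph homomorphism from a tree that is bijective on the neighbours of each vertex), and for some $s\in SG$ the map $s\circ\phi$ is the universal covering of $\tau_{0,1}$. In particular: - $\phi$ is injective on every closed ball of radius $1$, and is conformal: at each vertex the three edges are mapped to segments of equal non-zero length, any two of which make the angle $2\pi/3$. - The image of a geodesic (a finite, infinite or bi-infinite injective path) of $T_3$ is a locally injective walk on $\tau$, i.e. a walk any three successive vertices of which are distinct. For infinite geodesics $S_0,S_1,\dots$ the image can be periodic, and it can tend to infinity; it is unbounded for a generic infinite geodesic, i.e. for a residual set of them in the space of infinite geodesics (with the topology of pointwise convergence). 3. For adjacent $a,b$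 and $\alpha\ne\beta$, the action of $H$ on $\mathcal H_{\alpha,\beta}(T_3)$ is simply transitive (in particular the space is non-empty), each orbit map $H\to\mathcal H_{\alpha,\beta}(T_3)$ is a homeomorphism, and both spaces are compact. 4. The action of $SG\times H$ on $Hol^*(T_3)$ is simply transitive, and each orbit map is a homeomorphism. 5. In contrast, the action of $SG\times Aut(T_3)$ on $Hol^*(T_3)$ is transitive but not free. The stabilizer of each $\phi$ in $SG\times Aut(T_3)$ is a non-trivial discrete group, whose projection to $SG$ is the group of the similarities that map the vertex set of $\tau$ onto itself; the kernel of this projection is the stabilizer $\Gamma=\{\gamma:\phi\circ\gamma=\phi\}$ of $\phi$ in $Aut(T_3)$. The group $\Gamma$ is discrete and acts freely on $T_3$ (a non-trivial element fixes no vertex and inverts no edge), and it is the fundamental group of the graph $\tau$: for each vertex $x$, sending $\gamma$ to the class of the image under $\phi$ of any walk from $x$ to $\gamma x$ is an isomorphism $\Gamma\to\pi_1(\tau,\phi(x))$. -/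

import Mathlib

open Set Filter Topology

noncomputable section

namespace HolTree

universe u v

/-! ### Harmonic and holomorphic functions on a graph -/

/-- The Laplacian `(1 / ν(x)) ∑_{y ~ x} f y - f x`; the term `f x` is put inside the mean, which
only matters at isolated vertices. -/
def laplacian {V : Type u} (G : SimpleGraph V) [G.LocallyFinite] (f : V → ℂ) (x : V) : ℂ :=
  (G.degree x : ℂ)⁻¹ * ∑ y ∈ G.neighborFinset x, (f y - f x)

def IsHarmonic {V : Type u} (G : SimpleGraph V) [G.LocallyFinite] (f : V → ℂ) : Prop :=
  ∀ x, laplacian G f x = 0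

/-- A function on a graph is holomorphic if it and its square are harmonic. -/
def IsHolomorphic {V : Type u} (G : SimpleGraph V) [G.LocallyFinite] (φ : V → ℂ) : Prop :=
  IsHarmonic G φ ∧ IsHarmonic G (fun x => φ x ^ 2)

/-- The non-constant holomorphic functions. As a subspace of the product `V → ℂ` this carries the
topology of pointwise convergence, which is the compact-open topology because the vertex set is
discrete. -/
abbrev HolStar {V : Type u} (G : SimpleGraph V) [G.LocallyFinite] : Type u :=
  {φ : V → ℂ // IsHolomorphic G φ ∧ ∃ x y, φ x ≠ φ y}

/-- The holomorphic functions with value `α` at `a` and `β` at `b`, with the same topology. -/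
abbrev HolValues {V : Type u} (G : SimpleGraph V) [G.LocallyFinite] (a b : V) (α β : ℂ) : Type u :=
  {φ : V → ℂ // IsHolomorphic G φ ∧ φ a = α ∧ φ b = β}

/-! ### The groups -/

/-- The maps `z ↦ θ z + t` of `ℂ` with `θ ≠ 0`. -/
abbrev SG : Type := ℂ ≃ᵃ[ℂ] ℂ

/-- The topology of `SG` is given by the coordinates `(θ, t)`. -/
instance : TopologicalSpace SG :=
  TopologicalSpace.induced (fun s : SG => ((s.linear 1, s 0) : ℂ × ℂ)) inferInstance

/-- The automorphism group of a graph. -/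
abbrev Aut {V : Type u} (G : SimpleGraph V) : Type u := G ≃g G

/-- The topology of pointwise convergence (equivalently compact-open) on the automorphism group. -/
instance {V : Type u} [TopologicalSpace V] (G : SimpleGraph V) : TopologicalSpace (Aut G) :=
  TopologicalSpace.induced (fun (γ : Aut G) (x : V) => γ x) inferInstance

/-- The automorphisms that fix both `a` and `b`. -/
def fixEdge {V : Type u} (G : SimpleGraph V) (a b : V) : Subgroup (Aut G) where
  carrier := {γ | γ a = a ∧ γ b = b}
  one_mem' := ⟨rfl, rfl⟩
  mul_mem' := by
    rintro γ δ ⟨h1, h2⟩ ⟨h3, h4⟩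
    exact ⟨by rw [RelIso.mul_apply, h3, h1], by rw [RelIso.mul_apply, h4, h2]⟩
  inv_mem' := by
    rintro γ ⟨h1, h2⟩
    exact ⟨(γ.symm_apply_eq).2 h1.symm, (γ.symm_apply_eq).2 h2.symm⟩

/-! ### The actions -/

theorem laplacian_comp_aut {V : Type u} (G : SimpleGraph V) [G.LocallyFinite] (γ : Aut G)
    (f : V → ℂ) (x : V) : laplacian G (fun y => f (γ y)) x = laplacian G f (γ x) := by
  have hs : ∑ y ∈ G.neighborFinset x, (f (γ y) - f (γ x))
      = ∑ y ∈ G.neighborFinset (γ x), (f y - f (γ x)) := by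
    refine Finset.sum_bij (fun y _ => γ y) ?_ ?_ ?_ ?_
    · intro y hy
      rw [SimpleGraph.mem_neighborFinset] at hy ⊢
      exact γ.map_rel_iff.2 hy
    · intro y _ z _ h
      exact γ.injective h
    · intro z hz
      rw [SimpleGraph.mem_neighborFinset] at hz
      refine ⟨γ.symm z, ?_, γ.apply_symm_apply z⟩
      rw [SimpleGraph.mem_neighborFinset]
      apply γ.map_rel_iff.1
      rwa [RelIso.apply_symm_apply]
    · intro y _
      rfl
  have hd : G.degree (γ x) = G.degree x := SimpleGraph.Iso.degree_eq γ x
  unfold laplacian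
  rw [hs, hd]

theorem IsHolomorphic.comp_aut {V : Type u} {G : SimpleGraph V} [G.LocallyFinite] {φ : V → ℂ}
    (h : IsHolomorphic G φ) (γ : Aut G) : IsHolomorphic G (fun x => φ (γ x)) := by
  refine ⟨fun x => ?_, fun x => ?_⟩
  · rw [laplacian_comp_aut]
    exact h.1 _
  · rw [laplacian_comp_aut G γ (fun y => φ y ^ 2)]
    exact h.2 _

theorem SG.apply_eq (s : SG) (z : ℂ) : s z = s.linear 1 * z + s 0 := by
  have h : s (z +ᵥ (0 : ℂ)) = s.linear z +ᵥ s 0 := s.map_vadd 0 z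
  have h2 : s.linear (z • (1 : ℂ)) = z • s.linear 1 := map_smul s.linear z 1
  simp only [vadd_eq_add, add_zero, smul_eq_mul, mul_one] at h h2
  rw [h, h2, mul_comm]

theorem IsHolomorphic.comp_similarity {V : Type u} {G : SimpleGraph V} [G.LocallyFinite]
    {φ : V → ℂ} (h : IsHolomorphic G φ) (s : SG) : IsHolomorphic G (fun x => s (φ x)) := by
  have key : ∀ x, laplacian G (fun x => s (φ x)) x = s.linear 1 * laplacian G φ x := by
    intro x
    unfold laplacian
    rw [mul_left_comm, Finset.mul_sum (f := fun y => φ y - φ x)]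
    congr 1
    apply Finset.sum_congr rfl
    intro y _
    simp only [SG.apply_eq s (φ y), SG.apply_eq s (φ x)]
    ring
  have key2 : ∀ x, laplacian G (fun x => s (φ x) ^ 2) x
      = s.linear 1 ^ 2 * laplacian G (fun x => φ x ^ 2) x
        + 2 * s.linear 1 * s 0 * laplacian G φ x := by
    intro x
    unfold laplacian
    rw [mul_left_comm, mul_left_comm (2 * s.linear 1 * s 0), ← mul_add,
      Finset.mul_sum (f := fun y => φ y ^ 2 - φ x ^ 2), Finset.mul_sum (f := fun y => φ y - φ x),
      ← Finset.sum_add_distrib]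
    congr 1
    refine Finset.sum_congr rfl fun y _ => ?_
    simp only [SG.apply_eq s (φ y), SG.apply_eq s (φ x)]
    ring
  refine ⟨fun x => ?_, fun x => ?_⟩
  · rw [key, h.1 x, mul_zero]
  · rw [key2, h.1 x, h.2 x, mul_zero, mul_zero, add_zero]

/-- `SG` acts on the left by `s • φ = s ∘ φ`. -/
instance {V : Type u} (G : SimpleGraph V) [G.LocallyFinite] : MulAction SG (HolStar G) where
  smul s φ := ⟨fun x => s (φ.1 x), φ.2.1.comp_similarity s, by
    obtain ⟨x, y, h⟩ := φ.2.2
    exact ⟨x, y, fun e => h (s.injective e)⟩⟩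
  one_smul _ := rfl
  mul_smul _ _ _ := rfl

/-- `Aut G` acts by composition, `γ • φ = φ ∘ γ⁻¹`. -/
instance {V : Type u} (G : SimpleGraph V) [G.LocallyFinite] :
    MulAction (Aut G) (HolStar G) where
  smul γ φ := ⟨fun x => φ.1 (γ⁻¹ x), φ.2.1.comp_aut γ⁻¹, by
    obtain ⟨x, y, h⟩ := φ.2.2
    refine ⟨γ x, γ y, ?_⟩
    have e : ∀ z, γ⁻¹ (γ z) = z := fun z => γ.symm_apply_apply z
    simpa only [e] using h⟩
  one_smul _ := rfl
  mul_smul γ δ φ := by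
    apply Subtype.ext
    funext x
    change φ.1 ((γ * δ)⁻¹ x) = φ.1 (δ⁻¹ (γ⁻¹ x))
    rw [mul_inv_rev, RelIso.mul_apply]

instance {V : Type u} (G : SimpleGraph V) [G.LocallyFinite] :
    SMulCommClass SG (Aut G) (HolStar G) := ⟨fun _ _ _ => rfl⟩

/-- The product action of `SG × K`, for `K` the group `Aut G` or one of its subgroups:
`(s, γ) • φ = s ∘ φ ∘ γ⁻¹`. -/
instance {V : Type u} (G : SimpleGraph V) [G.LocallyFinite] (K : Type u) [Group K]
    [MulAction K (HolStar G)] [SMulCommClass SG K (HolStar G)] :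
    MulAction (SG × K) (HolStar G) where
  smul g φ := g.1 • g.2 • φ
  one_smul φ := by
    change (1 : SG) • (1 : K) • φ = φ
    rw [one_smul, one_smul]
  mul_smul g h φ := by
    change (g.1 * h.1) • (g.2 * h.2) • φ = g.1 • g.2 • h.1 • h.2 • φ
    rw [mul_smul, mul_smul, smul_comm h.1 g.2]

/-- The automorphisms that fix `a` and `b` act on `HolValues G a b α β` by
`γ • φ = φ ∘ γ⁻¹`. -/
instance {V : Type u} (G : SimpleGraph V) [G.LocallyFinite] (a b : V) (α β : ℂ) :
    MulAction (fixEdge G a b) (HolValues G a b α β) where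
  smul γ φ := ⟨fun x => φ.1 ((γ⁻¹ : fixEdge G a b).1 x), φ.2.1.comp_aut _, by
    have h1 : (γ⁻¹ : fixEdge G a b).1 a = a := (γ⁻¹ : fixEdge G a b).2.1
    have h2 : (γ⁻¹ : fixEdge G a b).1 b = b := (γ⁻¹ : fixEdge G a b).2.2
    exact ⟨(congrArg φ.1 h1).trans φ.2.2.1, (congrArg φ.1 h2).trans φ.2.2.2⟩⟩
  one_smul _ := rfl
  mul_smul γ δ φ := by
    apply Subtype.ext
    funext x
    change φ.1 (((γ * δ)⁻¹ : fixEdge G a b).1 x)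
      = φ.1 ((δ⁻¹ : fixEdge G a b).1 ((γ⁻¹ : fixEdge G a b).1 x))
    rw [mul_inv_rev, Subgroup.coe_mul, RelIso.mul_apply]

/-- A simply transitive action: on a non-empty set, any point is carried to any other by exactly
one group element. -/
def IsSimplyTransitive (K : Type u) (X : Type v) [Group K] [MulAction K X] : Prop :=
  Nonempty X ∧ ∀ x y : X, ∃! k : K, k • x = y

/-! ### The hexagonal tiling -/

/-- The cubic root of unity `exp (2πi/3)`. -/
def jRoot : ℂ := Complex.exp (2 * Real.pi / 3 * Complex.I)

/-- The regular hexagon with edge from `α` to `β`, listed by its successive vertices. -/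
def fundamentalHexagon (α β : ℂ) : Fin 6 → ℂ :=
  let w := β - α
  let j := jRoot
  ![α, α + w, α + w - j * w, α + w - j * w + j ^ 2 * w, α + w - j * w + j ^ 2 * w - w,
    α + w - j * w + j ^ 2 * w - w + j * w]

/-- The tiles of the tiling: all hexagons obtained from the fundamental one by repeated reflection
in the edges. Indices are taken modulo `6`. -/
inductive IsTile (α β : ℂ) : (Fin 6 → ℂ) → Prop
  | base : IsTile α β (fundamentalHexagon α β)
  | reflect (h : Fin 6 → ℂ) (k : Fin 6) (hh : IsTile α β h) :
      IsTile α β (fun i => EuclideanGeometry.reflection line[ℝ, h k, h (k + 1)] (h i))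

/-- The vertices of the tiling. -/
def hexVertices (α β : ℂ) : Set ℂ := {z | ∃ h, IsTile α β h ∧ ∃ k, h k = z}

/-- The graph (1-skeleton) of the tiling: two vertices are joined by an edge if they are successive
vertices of a tile. -/
def hexGraph (α β : ℂ) : SimpleGraph (hexVertices α β) :=
  SimpleGraph.fromRel fun z z' => ∃ h, IsTile α β h ∧ ∃ k, h k = z ∧ h (k + 1) = z'

/-! ### Coverings and geometry -/

/-- A covering of graphs: a surjective homomorphism that is bijective on the star of each
vertex. -/
def IsCovering {V : Type u} {W : Type v} {G : SimpleGraph V} {H : SimpleGraph W}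
    (f : G →g H) : Prop :=
  Function.Surjective f ∧ ∀ x, BijOn f (G.neighborSet x) (H.neighborSet (f x))

/-- A universal covering: a covering by a connected and simply connected graph, that is, by a
tree. -/
def IsUniversalCovering {V : Type u} {W : Type v} {G : SimpleGraph V} {H : SimpleGraph W}
    (f : G →g H) : Prop :=
  G.IsTree ∧ IsCovering f

/-- Injective on each closed ball of radius `1`. -/
def IsLocallyInjective {V : Type u} (G : SimpleGraph V) (φ : V → ℂ) : Prop :=
  ∀ x, InjOn φ {y | G.dist x y ≤ 1}

/-- Conformality for a graph of valency `3`: at each vertex the three edges are mapped to segments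
of the same non-zero length, any two of them with angle `2π/3`. -/
def IsConformal {V : Type u} (G : SimpleGraph V) (φ : V → ℂ) : Prop :=
  ∀ x y z, G.Adj x y → G.Adj x z → y ≠ z →
    0 < dist (φ x) (φ y) ∧ dist (φ x) (φ y) = dist (φ x) (φ z) ∧
      EuclideanGeometry.angle (φ y) (φ x) (φ z) = 2 * Real.pi / 3

/-- A walk parametrised by the interval `I` of integers. -/
def IsWalkOn {V : Type u} (G : SimpleGraph V) (I : Set ℤ) (S : ℤ → V) : Prop :=
  ∀ n, n ∈ I → n + 1 ∈ I → G.Adj (S n) (S (n + 1))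

/-- A geodesic (injective path) parametrised by the interval `I` of integers. -/
def IsGeodesicOn {V : Type u} (G : SimpleGraph V) (I : Set ℤ) (S : ℤ → V) : Prop :=
  IsWalkOn G I S ∧ InjOn S I

/-- A locally injective walk: any three successive vertices are distinct. -/
def IsLocallyInjectiveWalkOn {V : Type u} (G : SimpleGraph V) (I : Set ℤ) (S : ℤ → V) : Prop :=
  IsWalkOn G I S ∧ (∀ n, n ∈ I → n + 1 ∈ I → S n ≠ S (n + 1)) ∧
    ∀ n, n ∈ I → n + 2 ∈ I → S n ≠ S (n + 2)

/-- The infinite geodesics `S 0, S 1, …`, as a subspace of the product space `ℕ → V`. -/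
abbrev Ray {V : Type u} (G : SimpleGraph V) : Type u :=
  {S : ℕ → V // (∀ n, G.Adj (S n) (S (n + 1))) ∧ Function.Injective S}

/-! ### The fundamental group of a graph -/

/-- Homotopy of walks with the same end points: the congruence generated by the removal of
backtracks. -/
inductive WalkHomotopic {W : Type v} (H : SimpleGraph W) :
    ∀ {x y : W}, H.Walk x y → H.Walk x y → Prop
  | refl {x y : W} (p : H.Walk x y) : WalkHomotopic H p p
  | symm {x y : W} {p q : H.Walk x y} : WalkHomotopic H p q → WalkHomotopic H q p
  | trans {x y : W} {p q r : H.Walk x y} :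
      WalkHomotopic H p q → WalkHomotopic H q r → WalkHomotopic H p r
  | cons {x y z : W} (h : H.Adj x y) {p q : H.Walk y z} :
      WalkHomotopic H p q → WalkHomotopic H (p.cons h) (q.cons h)
  | backtrack {x y z : W} (h : H.Adj x y) (p : H.Walk x z) :
      WalkHomotopic H ((p.cons h.symm).cons h) p

theorem WalkHomotopic.append_right {W : Type v} {H : SimpleGraph W} {x y z : W}
    {p q : H.Walk x y} (h : WalkHomotopic H p q) (r : H.Walk y z) :
    WalkHomotopic H (p.append r) (q.append r) := by
  induction h with
  | refl p => exact .refl _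
  | symm _ ih => exact .symm (ih r)
  | trans _ _ ih1 ih2 => exact .trans (ih1 r) (ih2 r)
  | cons e _ ih => exact .cons e (ih r)
  | backtrack e p => exact .backtrack e _

theorem WalkHomotopic.append_left {W : Type v} {H : SimpleGraph W} {x y z : W}
    (p : H.Walk x y) {q r : H.Walk y z} (h : WalkHomotopic H q r) :
    WalkHomotopic H (p.append q) (p.append r) := by
  induction p with
  | nil => exact h
  | cons e _ ih => exact .cons e (ih h)

theorem WalkHomotopic.reverse_append {W : Type v} {H : SimpleGraph W} {x y : W}
    (p : H.Walk x y) : WalkHomotopic H (p.reverse.append p) SimpleGraph.Walk.nil := by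
  induction p with
  | nil => exact .refl _
  | cons e p ih =>
    rw [SimpleGraph.Walk.reverse_cons, ← SimpleGraph.Walk.append_assoc,
      SimpleGraph.Walk.cons_append, SimpleGraph.Walk.nil_append]
    exact .trans (.append_left _ (.backtrack e.symm p)) ih

theorem WalkHomotopic.reverse {W : Type v} {H : SimpleGraph W} {x y : W}
    {p q : H.Walk x y} (h : WalkHomotopic H p q) : WalkHomotopic H p.reverse q.reverse := by
  have h1 : WalkHomotopic H (p.reverse.append (q.append q.reverse)) p.reverse := by
    have h0 := WalkHomotopic.reverse_append q.reverse
    rw [SimpleGraph.Walk.reverse_reverse] at h0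
    have := WalkHomotopic.append_left p.reverse h0
    rwa [SimpleGraph.Walk.append_nil] at this
  have h2 : WalkHomotopic H ((p.reverse.append q).append q.reverse) q.reverse :=
    .append_right (.trans (.append_left _ (.symm h)) (.reverse_append p)) q.reverse
  rw [SimpleGraph.Walk.append_assoc] at h1
  exact .trans (.symm h1) h2

def walkSetoid {W : Type v} (H : SimpleGraph W) (x : W) : Setoid (H.Walk x x) where
  r := WalkHomotopic H
  iseqv := ⟨.refl, .symm, .trans⟩

/-- The fundamental group of a graph (edge-path group): closed walks at `x` up to homotopy, with
concatenation. -/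
def GraphPi1 {W : Type v} (H : SimpleGraph W) (x : W) : Type v := Quotient (walkSetoid H x)

/-- The class of a closed walk. -/
def GraphPi1.mk {W : Type v} {H : SimpleGraph W} {x : W} (p : H.Walk x x) : GraphPi1 H x :=
  Quotient.mk (walkSetoid H x) p

instance {W : Type v} (H : SimpleGraph W) (x : W) : Group (GraphPi1 H x) where
  mul := Quotient.map₂ (fun p q => p.append q) fun _ p' hp q _ hq =>
    WalkHomotopic.trans (WalkHomotopic.append_right hp q) (WalkHomotopic.append_left p' hq)
  one := GraphPi1.mk SimpleGraph.Walk.nil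
  inv := Quotient.map (fun p => p.reverse) fun _ _ h => WalkHomotopic.reverse h
  mul_assoc := by
    rintro ⟨p⟩ ⟨q⟩ ⟨r⟩
    exact congrArg GraphPi1.mk (SimpleGraph.Walk.append_assoc p q r).symm
  one_mul := by
    rintro ⟨p⟩
    rfl
  mul_one := by
    rintro ⟨p⟩
    exact congrArg GraphPi1.mk (SimpleGraph.Walk.append_nil p)
  inv_mul_cancel := by
    rintro ⟨p⟩
    exact Quotient.sound (WalkHomotopic.reverse_append p)

end HolTree

end

open HolTree

/-!
The increments `d, e, f` of a holomorphic function along the three edges at a vertex satisfy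
`d + e + f = 0` and `d² + e² + f² = 0`, so they are `d, j d, j² d` in some order
(`IsHolomorphic.exists_neighbors`). Along an edge the increment only changes its sign when it is
seen from the other end. Hence, if the function is constant on one edge it is constant, and
otherwise the values `α, β` on one edge determine the increments everywhere up to order: with
`w = β - α`, all values lie in `α + w ℤ[j]`, and the increments at `x` are `w jᵏ` or `- w jᵏ`
according to the class of `(φ x - α) / w` in `ℤ[j] / (1 - j) = 𝔽₃`, which is `0` or `1`
(`IsHolomorphic.exists_class`).

The same classes describe the tiling. Reflecting a tile in an edge moves its centre, in the
coordinate `(z - α) / w`, by a unit times `1 - j`, so that the centres are exactly the Eisenstein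
integers of class `2` (`IsTile.exists_eq`, `exists_isTile`). The vertices are those of the classes
`0` and `1` (`mem_hexVertices_iff`), and the edges join the vertices at minimal distance `|w|`
(`hexGraph_adj_iff`). So a non-constant holomorphic function maps the neighbours of each vertex
bijectively to the neighbours of its image in the tiling (`IsHolomorphic.isStarCover`).

Everything else is covering theory on a tree. Two coverings of the tiling by the tree differ by an
automorphism, unique once it is prescribed at one vertex (`IsStarCover.exists_aut`,
`IsStarCover.aut_ext`); this gives the simply transitive actions, and the stabilizers, since a
similarity that permutes the vertices of the tiling preserves the minimal distance. The lift depends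
continuously on the covering (`eventually_lift_eq`), which makes the orbit maps homeomorphisms.
Non-emptiness of the spaces comes from a recursion along the tree (`exists_isHolomorphic`), and
compactness from the fact that all increments have length `|w|`. The fundamental group of the
tiling is compared with the stabilizer through the end points of lifted walks
(`exists_mulEquiv_graphPi1`). Finally, a holomorphic function lets one walk in the tree with
prescribed left and right turns in the tiling (`IsHolomorphic.exists_walk_turning`): always turning
to one side gives a periodic ray, alternating gives a ray that tends to infinity, and such a zigzag
can follow any given initial path, so that unbounded rays are dense.
-/

noncomputable section

namespace HolTree

universe u v

/-! ### Trees -/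

section Tree

variable {V : Type u} {G : SimpleGraph V}

theorem connected_induction (hG : G.Connected) {P : V → Prop} (a : V) (ha : P a)
    (hstep : ∀ x y, G.Adj x y → P x → P y) (x : V) : P x := by
  obtain ⟨p⟩ := hG.preconnected a x
  induction p with
  | nil => exact ha
  | cons h _ ih => exact ih (hstep _ _ h ha)

theorem exists_adj_dist_succ (hG : G.Connected) {a x : V} (hx : x ≠ a) :
    ∃ y, G.Adj y x ∧ G.dist a x = G.dist a y + 1 := by
  obtain ⟨p, hp⟩ := hG.exists_walk_length_eq_dist x a
  cases p with
  | nil => exact absurd rfl hx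
  | @cons _ y _ h q =>
    refine ⟨y, h.symm, ?_⟩
    have h1 := SimpleGraph.dist_le q
    have h2 := h.diff_dist_adj (u := a)
    rw [SimpleGraph.Walk.length_cons] at hp
    rw [SimpleGraph.dist_comm] at hp h1
    omega

theorem eq_of_adj_of_dist_succ (hT : G.IsTree) {a x y z : V} (hy : G.Adj y x) (hz : G.Adj z x)
    (hdy : G.dist a x = G.dist a y + 1) (hdz : G.dist a x = G.dist a z + 1) : y = z := by
  obtain ⟨p, hp⟩ := hT.1.exists_walk_length_eq_dist a y
  obtain ⟨q, hq⟩ := hT.1.exists_walk_length_eq_dist a z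
  have h1 : (p.concat hy).IsPath :=
    SimpleGraph.Walk.isPath_of_length_eq_dist _ (by rw [SimpleGraph.Walk.length_concat, hp, hdy])
  have h2 : (q.concat hz).IsPath :=
    SimpleGraph.Walk.isPath_of_length_eq_dist _ (by rw [SimpleGraph.Walk.length_concat, hq, hdz])
  have h3 := (hT.existsUnique_path a x).unique h1 h2
  have h4 := congrArg SimpleGraph.Walk.penultimate h3
  simpa using h4

/-- Functions on a tree can be defined recursively, from a root outwards. -/
theorem exists_tree_recursion {S : Type v} (hT : G.IsTree) (a : V) (s₀ : S) (F : V → V → S → S) :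
    ∃ σ : V → S, σ a = s₀ ∧
      ∀ x y, G.Adj x y → G.dist a y = G.dist a x + 1 → σ y = F x y (σ x) := by
  classical
  have hpar : ∀ y, ∃ x, y ≠ a → G.Adj x y ∧ G.dist a y = G.dist a x + 1 := by
    intro y
    by_cases hy : y = a
    · exact ⟨a, fun h => absurd hy h⟩
    · obtain ⟨x, hx⟩ := exists_adj_dist_succ hT.1 hy
      exact ⟨x, fun _ => hx⟩
  choose par hpar using hpar
  let τ : ℕ → V → S := fun n => Nat.rec (fun _ => s₀) (fun _ t y => F (par y) y (t (par y))) n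
  refine ⟨fun y => τ (G.dist a y) y, ?_, fun x y hxy hd => ?_⟩
  · simp [τ]
  · have hy : y ≠ a := by
      rintro rfl
      simp at hd
    obtain ⟨h1, h2⟩ := hpar y hy
    have hx : par y = x := eq_of_adj_of_dist_succ hT h1 hxy h2 hd
    change τ (G.dist a y) y = F x y (τ (G.dist a x) x)
    rw [hd]
    change F (par y) y (τ (G.dist a x) (par y)) = _
    rw [hx]

/-- A walk without backtracking in a tree moves away from each of its vertices. -/
theorem dist_of_nonbacktracking (hT : G.IsTree) {S : ℕ → V} (hS : ∀ n, G.Adj (S n) (S (n + 1)))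
    (hb : ∀ n, S (n + 2) ≠ S n) (m k : ℕ) : G.dist (S m) (S (m + k)) = k := by
  induction k using Nat.strong_induction_on with
  | _ k ih =>
    match k, ih with
    | 0, _ => simp
    | 1, _ => exact SimpleGraph.dist_eq_one_iff_adj.2 (hS m)
    | k + 2, ih =>
      have h0 := ih k (by omega)
      have h1 := ih (k + 1) (by omega)
      rcases hT.dist_eq_dist_add_one_of_adj (S m) (hS (m + (k + 1))) with h | h
      · exact absurd (eq_of_adj_of_dist_succ hT (hS (m + (k + 1))).symm (hS (m + k)) h
          (by rw [h0]; exact h1)) (hb (m + k))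
      · rw [h1] at h
        omega

theorem injective_of_nonbacktracking (hT : G.IsTree) {S : ℕ → V}
    (hS : ∀ n, G.Adj (S n) (S (n + 1))) (hb : ∀ n, S (n + 2) ≠ S n) : Function.Injective S := by
  have key : ∀ m k, S m = S (m + k) → k = 0 := by
    intro m k h
    rw [← dist_of_nonbacktracking hT hS hb m k, ← h, SimpleGraph.dist_self]
  intro m n h
  rcases le_total m n with hmn | hmn
  · obtain ⟨k, rfl⟩ := Nat.exists_eq_add_of_le hmn
    rw [key m k h, add_zero]
  · obtain ⟨k, rfl⟩ := Nat.exists_eq_add_of_le hmn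
    rw [key n k h.symm, add_zero]

end Tree

/-! ### Covering maps described by stars, and lifting -/

section Lift

variable {V : Type u} {V' : Type u} {W : Type v} {G : SimpleGraph V} {G' : SimpleGraph V'}

/-- A map `φ` to a set `W`, in which each point `z` has been given a star `St z`, that maps the
neighbours of each vertex `x` bijectively to `St (φ x)`. -/
def IsStarCover (G : SimpleGraph V) (St : W → Set W) (φ : V → W) : Prop :=
  ∀ x, BijOn φ (G.neighborSet x) (St (φ x))

theorem IsStarCover.lift_unique {St : W → Set W} {ψ : V' → W} (hψ : IsStarCover G' St ψ)
    (hG : G.Connected) {γ δ : V → V'} (hγ : ∀ x y, G.Adj x y → G'.Adj (γ x) (γ y))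
    (hδ : ∀ x y, G.Adj x y → G'.Adj (δ x) (δ y)) (h : ∀ x, ψ (γ x) = ψ (δ x)) {a : V}
    (ha : γ a = δ a) (x : V) : γ x = δ x := by
  refine connected_induction hG (P := fun x => γ x = δ x) a ha (fun x y hxy hx => ?_) x
  refine (hψ (γ x)).injOn (hγ x y hxy) ?_ (h y)
  rw [hx]
  exact hδ x y hxy

theorem IsStarCover.exists_lift {St : W → Set W} {φ : V → W} {ψ : V' → W}
    (hφ : IsStarCover G St φ) (hψ : IsStarCover G' St ψ) (hT : G.IsTree) {a : V} {a' : V'}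
    (ha : φ a = ψ a') :
    ∃ γ : V → V', γ a = a' ∧ (∀ x y, G.Adj x y → G'.Adj (γ x) (γ y)) ∧ ∀ x, ψ (γ x) = φ x := by
  classical
  obtain ⟨γ, hγa, hγ⟩ := exists_tree_recursion hT a a'
    (fun _ y s => if h : ∃ v, G'.Adj s v ∧ ψ v = φ y then h.choose else s)
  have step : ∀ x y, G.Adj x y → G.dist a y = G.dist a x + 1 → ψ (γ x) = φ x →
      G'.Adj (γ x) (γ y) ∧ ψ (γ y) = φ y := by
    intro x y hxy hd hx
    have hex : ∃ v, G'.Adj (γ x) v ∧ ψ v = φ y := by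
      have h1 : φ y ∈ St (ψ (γ x)) := by
        rw [hx]
        exact (hφ x).mapsTo hxy
      obtain ⟨v, hv, hv'⟩ := (hψ (γ x)).surjOn h1
      exact ⟨v, hv, hv'⟩
    have h2 := hγ x y hxy hd
    rw [dif_pos hex] at h2
    rw [h2]
    exact hex.choose_spec
  have hval : ∀ n x, G.dist a x = n → ψ (γ x) = φ x := by
    intro n
    induction n with
    | zero =>
      intro x hx
      obtain rfl := hT.1.dist_eq_zero_iff.1 hx
      rw [hγa, ha]
    | succ n ih =>
      intro x hx
      have hxa : x ≠ a := by
        rintro rfl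
        simp at hx
      obtain ⟨y, hy, hd⟩ := exists_adj_dist_succ hT.1 hxa
      exact (step y x hy hd (ih y (by omega))).2
  refine ⟨γ, hγa, fun x y hxy => ?_, fun x => hval _ x rfl⟩
  rcases hT.dist_eq_dist_add_one_of_adj a hxy with h | h
  · exact (step y x hxy.symm h (hval _ y rfl)).1.symm
  · exact (step x y hxy h (hval _ x rfl)).1

/-- Two coverings of the same object by a tree differ by an automorphism, which can be prescribed
at one vertex. -/
theorem IsStarCover.exists_aut {St : W → Set W} {φ ψ : V → W} (hφ : IsStarCover G St φ)
    (hψ : IsStarCover G St ψ) (hT : G.IsTree) {a a' : V} (ha : φ a = ψ a') :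
    ∃ γ : Aut G, γ a = a' ∧ ∀ x, ψ (γ x) = φ x := by
  obtain ⟨γ, hγa, hγ, hγψ⟩ := hφ.exists_lift hψ hT ha
  obtain ⟨δ, hδa, hδ, hδφ⟩ := hψ.exists_lift hφ hT ha.symm
  have h1 : ∀ x, δ (γ x) = x := hφ.lift_unique hT.1 (γ := fun x => δ (γ x)) (δ := id)
    (fun x y h => hδ _ _ (hγ _ _ h)) (fun _ _ h => h) (fun x => by rw [hδφ, hγψ]; rfl)
    (a := a) (by rw [hγa, hδa]; rfl)
  have h2 : ∀ x, γ (δ x) = x := hψ.lift_unique hT.1 (γ := fun x => γ (δ x)) (δ := id)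
    (fun x y h => hγ _ _ (hδ _ _ h)) (fun _ _ h => h) (fun x => by rw [hγψ, hδφ]; rfl)
    (a := a') (by rw [hδa, hγa]; rfl)
  refine ⟨⟨⟨γ, δ, h1, h2⟩, ?_⟩, hγa, hγψ⟩
  intro x y
  refine ⟨fun h => ?_, hγ x y⟩
  have := hδ _ _ h
  simpa [h1] using this

theorem IsStarCover.aut_ext {St : W → Set W} {ψ : V → W} (hψ : IsStarCover G St ψ)
    (hG : G.Connected) {γ δ : Aut G} (h : ∀ x, ψ (γ x) = ψ (δ x)) {a : V} (ha : γ a = δ a) :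
    γ = δ :=
  RelIso.ext (hψ.lift_unique hG (fun _ _ h => γ.map_rel_iff.2 h) (fun _ _ h => δ.map_rel_iff.2 h)
    h ha)

/-- Lifts through a continuously varying covering are locally constant at every vertex as soon as
they are so at one vertex: the lift of an edge is selected by finitely many conditions of the form
`ψ v ≠ z`, which are open. -/
theorem eventually_lift_eq {X : Type*} [TopologicalSpace X] [TopologicalSpace W] [T2Space W]
    [G'.LocallyFinite] (hG : G.Connected) {φ : X → V → W} {ψ : X → V' → W} {γ : X → V → V'}
    (hφc : ∀ x, Continuous fun t => φ t x) (hψc : ∀ x, Continuous fun t => ψ t x)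
    (hψ : ∀ t x, InjOn (ψ t) (G'.neighborSet x))
    (hγ : ∀ t x y, G.Adj x y → G'.Adj (γ t x) (γ t y)) (h : ∀ t x, ψ t (γ t x) = φ t x)
    (t₀ : X) {a : V} (ha : ∀ᶠ t in 𝓝 t₀, γ t a = γ t₀ a) (x : V) :
    ∀ᶠ t in 𝓝 t₀, γ t x = γ t₀ x := by
  refine connected_induction hG (P := fun x => ∀ᶠ t in 𝓝 t₀, γ t x = γ t₀ x) a ha
    (fun x y hxy hx => ?_) x
  have hfin : ∀ v ∈ G'.neighborFinset (γ t₀ x),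
      ∀ᶠ t in 𝓝 t₀, v ≠ γ t₀ y → ψ t v ≠ φ t y := by
    intro v hv
    rw [SimpleGraph.mem_neighborFinset] at hv
    by_cases hvy : v = γ t₀ y
    · exact Eventually.of_forall fun _ h => absurd hvy h
    · have hne : ψ t₀ v ≠ φ t₀ y := by
        rw [← h]
        exact fun e => hvy (hψ t₀ (γ t₀ x) hv (hγ t₀ x y hxy) e)
      have := (isOpen_ne_fun (hψc v) (hφc y)).mem_nhds hne
      filter_upwards [this] with t ht _ using ht
  have hall := (Finset.eventually_all _).2 hfin
  filter_upwards [hx, hall] with t ht1 ht2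
  by_contra hne
  refine ht2 (γ t y) ?_ hne (h t y)
  rw [SimpleGraph.mem_neighborFinset, ← ht1]
  exact hγ t x y hxy

end Lift

/-! ### The fundamental group as a group of automorphisms of the covering tree -/

section Pi1

variable {V : Type u} {W : Type v} {G : SimpleGraph V} {H : SimpleGraph W}

theorem WalkHomotopic.map {x y : V} {p q : G.Walk x y} (f : G →g H) (h : WalkHomotopic G p q) :
    WalkHomotopic H (p.map f) (q.map f) := by
  induction h with
  | refl p => exact .refl _
  | symm _ ih => exact .symm ih
  | trans _ _ ih1 ih2 => exact .trans ih1 ih2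
  | cons e _ ih => exact .cons (f.map_rel e) ih
  | backtrack e p => exact .backtrack (f.map_rel e) _

theorem WalkHomotopic.copy {x y x' y' : V} {p q : G.Walk x y} (h : WalkHomotopic G p q)
    (hx : x = x') (hy : y = y') : WalkHomotopic G (p.copy hx hy) (q.copy hx hy) := by
  subst hx hy
  exact h

/-- In a forest, removing backtracks turns every walk into a path. -/
theorem exists_isPath_walkHomotopic (hT : G.IsAcyclic) {x y : V} (p : G.Walk x y) :
    ∃ q : G.Walk x y, q.IsPath ∧ WalkHomotopic G p q := by
  classical
  induction p with
  | nil => exact ⟨_, SimpleGraph.Walk.IsPath.nil, .refl _⟩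
  | @cons x y z h p ih =>
    obtain ⟨q, hq, hpq⟩ := ih
    by_cases hx : x ∈ q.support
    · refine ⟨q.dropUntil x hx, hq.dropUntil hx, .trans (.cons h hpq) ?_⟩
      have h1 : (SimpleGraph.Walk.cons h.symm SimpleGraph.Walk.nil).IsPath := by
        simp [h.ne']
      have h2 : q.takeUntil x hx = SimpleGraph.Walk.cons h.symm SimpleGraph.Walk.nil :=
        congrArg Subtype.val ((hT.subsingleton_path _ _).elim ⟨_, hq.takeUntil hx⟩ ⟨_, h1⟩)
      have h3 := q.take_spec hx
      rw [h2, SimpleGraph.Walk.cons_append, SimpleGraph.Walk.nil_append] at h3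
      conv_lhs => rw [← h3]
      exact .backtrack h _
    · exact ⟨.cons h q, hq.cons hx, .cons h hpq⟩

theorem walkHomotopic_of_isAcyclic (hT : G.IsAcyclic) {x y : V} (p q : G.Walk x y) :
    WalkHomotopic G p q := by
  obtain ⟨p', hp', hpp'⟩ := exists_isPath_walkHomotopic hT p
  obtain ⟨q', hq', hqq'⟩ := exists_isPath_walkHomotopic hT q
  have : p' = q' := congrArg Subtype.val ((hT.subsingleton_path _ _).elim ⟨p', hp'⟩ ⟨q', hq'⟩)
  subst this
  exact .trans hpp' (.symm hqq')

open Classical in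
/-- A neighbour of `x` over `v` if there is one, and `x` itself otherwise. -/
def nbOver (G : SimpleGraph V) (f : V → W) (x : V) (v : W) : V :=
  if h : ∃ y, G.Adj x y ∧ f y = v then h.choose else x

/-- The end point of the lift starting at `x` of a walk in the base; it is meaningful if the walk
starts at `f x` and `f` is a covering. -/
def liftEnd (G : SimpleGraph V) (f : V → W) : ∀ {u w : W}, H.Walk u w → V → V
  | _, _, .nil, x => x
  | _, _, .cons (v := v) _ p, x => liftEnd G f p (nbOver G f x v)

variable {f : G →g H}

theorem nbOver_spec (hf : ∀ x, BijOn f (G.neighborSet x) (H.neighborSet (f x))) {x : V} {v : W}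
    (h : H.Adj (f x) v) : G.Adj x (nbOver G f x v) ∧ f (nbOver G f x v) = v := by
  have hex : ∃ y, G.Adj x y ∧ f y = v := (hf x).surjOn h
  rw [nbOver, dif_pos hex]
  exact hex.choose_spec

theorem nbOver_apply (hf : ∀ x, BijOn f (G.neighborSet x) (H.neighborSet (f x))) {x y : V}
    (h : G.Adj x y) : nbOver G f x (f y) = y := by
  obtain ⟨h1, h2⟩ := nbOver_spec hf (f.map_rel h)
  exact (hf x).injOn h1 h h2

theorem liftEnd_copy {u w u' w' : W} (p : H.Walk u w) (hu : u = u') (hw : w = w') (x : V) :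
    liftEnd G f (p.copy hu hw) x = liftEnd G f p x := by
  subst hu hw
  rfl

theorem liftEnd_map (hf : ∀ x, BijOn f (G.neighborSet x) (H.neighborSet (f x))) {x y : V}
    (p : G.Walk x y) : liftEnd G f (p.map f) x = y := by
  induction p with
  | nil => rfl
  | @cons x y z h p ih =>
    change liftEnd G f (p.map f) (nbOver G f x (f y)) = z
    rw [nbOver_apply hf h, ih]

theorem exists_walk_liftEnd (hf : ∀ x, BijOn f (G.neighborSet x) (H.neighborSet (f x)))
    {u w : W} (p : H.Walk u w) : ∀ x, f x = u →
      ∃ q : G.Walk x (liftEnd G f p x), q.support.map f = p.support := by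
  induction p with
  | nil =>
    rintro x rfl
    exact ⟨.nil, rfl⟩
  | @cons u v w h p ih =>
    rintro x rfl
    obtain ⟨h1, h2⟩ := nbOver_spec hf h
    obtain ⟨q, hq⟩ := ih _ h2
    refine ⟨.cons h1 q, ?_⟩
    change f x :: q.support.map f = f x :: p.support
    rw [hq]

/-- Homotopic walks have lifts with the same end point. -/
theorem liftEnd_eq_of_walkHomotopic
    (hf : ∀ x, BijOn f (G.neighborSet x) (H.neighborSet (f x))) {u w : W} {p q : H.Walk u w}
    (h : WalkHomotopic H p q) : ∀ x, f x = u → liftEnd G f p x = liftEnd G f q x := by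
  induction h with
  | refl p => exact fun _ _ => rfl
  | symm _ ih => exact fun x hx => (ih x hx).symm
  | trans _ _ ih1 ih2 => exact fun x hx => (ih1 x hx).trans (ih2 x hx)
  | cons e _ ih =>
    rintro x rfl
    exact ih _ (nbOver_spec hf e).2
  | @backtrack u v w e p =>
    rintro x rfl
    change liftEnd G f p (nbOver G f (nbOver G f x v) (f x)) = _
    rw [nbOver_apply hf (nbOver_spec hf e).1.symm]

theorem apply_liftEnd (hf : ∀ x, BijOn f (G.neighborSet x) (H.neighborSet (f x)))
    {u w : W} (p : H.Walk u w) : ∀ x, f x = u → f (liftEnd G f p x) = w := by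
  induction p with
  | nil => exact fun _ h => h
  | cons h p ih =>
    rintro x rfl
    exact ih _ (nbOver_spec hf h).2

theorem GraphPi1.mk_eq_mk {x : W} {p q : H.Walk x x} :
    GraphPi1.mk p = GraphPi1.mk q ↔ WalkHomotopic H p q :=
  ⟨fun h => Quotient.exact h, fun h => Quotient.sound h⟩

/-- The automorphisms over which a covering by a tree is invariant form the fundamental group of
the base. -/
theorem exists_mulEquiv_graphPi1 (hT : G.IsTree)
    (hf : ∀ x, BijOn f (G.neighborSet x) (H.neighborSet (f x))) (K : Subgroup (Aut G))
    (hK : ∀ γ, γ ∈ K ↔ ∀ x, f (γ x) = f x) (x : V) :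
    ∃ e : K ≃* GraphPi1 H (f x), ∀ (γ : K) (p : G.Walk x (γ.1 x)) (h : f (γ.1 x) = f x),
      e γ = GraphPi1.mk ((p.map f).copy rfl h) := by
  have hfs : ∀ (γ : K) y, f (γ.1 y) = f y := fun γ => (hK γ.1).1 γ.2
  let P : ∀ γ : K, G.Walk x (γ.1 x) := fun γ => (hT.1.preconnected x (γ.1 x)).some
  let E : K → GraphPi1 H (f x) := fun γ => GraphPi1.mk (((P γ).map f).copy rfl (hfs γ x))
  have hE : ∀ (γ : K) (p : G.Walk x (γ.1 x)) (h : f (γ.1 x) = f x),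
      E γ = GraphPi1.mk ((p.map f).copy rfl h) := fun γ p h =>
    GraphPi1.mk_eq_mk.2 (((walkHomotopic_of_isAcyclic hT.2 (P γ) p).map f).copy rfl h)
  have hmul : ∀ γ δ : K, E (γ * δ) = E γ * E δ := by
    intro γ δ
    obtain ⟨R, hR⟩ : ∃ R : G.Walk x ((γ * δ).1 x),
        R.support = (P γ).support ++ ((P δ).support.map γ.1).tail := by
      refine ⟨((P γ).append ((P δ).map γ.1.toHom) : G.Walk x (γ.1 (δ.1 x))), ?_⟩
      refine (SimpleGraph.Walk.support_append _ _).trans (congrArg (_ ++ List.tail ·) ?_)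
      exact SimpleGraph.Walk.support_map _ _
    rw [hE (γ * δ) R (hfs _ x)]
    change _ = GraphPi1.mk ((((P γ).map f).copy rfl (hfs γ x)).append
      (((P δ).map f).copy rfl (hfs δ x)))
    refine congrArg GraphPi1.mk (SimpleGraph.Walk.ext_support ?_)
    have h1 : (f ∘ γ.1 : V → W) = f := funext fun y => hfs γ y
    simp only [SimpleGraph.Walk.support_copy, SimpleGraph.Walk.support_map,
      SimpleGraph.Walk.support_append, hR, List.map_append, List.map_tail, List.map_map]
    rw [h1]
  have hend : ∀ γ : K, ∀ p : H.Walk (f x) (f x), E γ = GraphPi1.mk p →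
      liftEnd G f p x = γ.1 x := by
    intro γ p h
    rw [← liftEnd_eq_of_walkHomotopic hf (GraphPi1.mk_eq_mk.1 h) x rfl, liftEnd_copy,
      liftEnd_map hf]
  have hcov : IsStarCover G H.neighborSet f := hf
  have hinj : Function.Injective E := by
    intro γ δ h
    refine Subtype.ext (hcov.aut_ext hT.1 (fun y => by rw [hfs γ y, hfs δ y]) (a := x) ?_)
    rw [← hend γ _ rfl, ← hend δ _ h.symm]
  have hsurj : Function.Surjective E := by
    rintro ⟨p⟩
    obtain ⟨γ, hγx, hγ⟩ := hcov.exists_aut hcov hT (a := x) (a' := liftEnd G f p x)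
      (apply_liftEnd hf p x rfl).symm
    obtain ⟨q, hq⟩ := exists_walk_liftEnd hf p x rfl
    refine ⟨⟨γ, (hK γ).2 hγ⟩, ?_⟩
    rw [hE ⟨γ, (hK γ).2 hγ⟩ (q.copy rfl hγx.symm) (hγ x)]
    refine congrArg GraphPi1.mk (SimpleGraph.Walk.ext_support ?_)
    rw [SimpleGraph.Walk.support_copy, SimpleGraph.Walk.support_map,
      SimpleGraph.Walk.support_copy, hq]
  exact ⟨MulEquiv.mk (Equiv.ofBijective E ⟨hinj, hsurj⟩) hmul, hE⟩

end Pi1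

/-! ### Eisenstein integers -/

theorem jRoot_re : jRoot.re = -(1 / 2) := by
  have h : (2 * Real.pi / 3 * Complex.I : ℂ) = ((Real.pi - Real.pi / 3 : ℝ) : ℂ) * Complex.I := by
    push_cast
    ring
  rw [jRoot, h, Complex.exp_ofReal_mul_I_re, Real.cos_pi_sub, Real.cos_pi_div_three]

theorem jRoot_im : jRoot.im = √3 / 2 := by
  have h : (2 * Real.pi / 3 * Complex.I : ℂ) = ((Real.pi - Real.pi / 3 : ℝ) : ℂ) * Complex.I := by
    push_cast
    ring
  rw [jRoot, h, Complex.exp_ofReal_mul_I_im, Real.sin_pi_sub, Real.sin_pi_div_three]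

theorem sqrt_three_mul_self : √3 * √3 = (3 : ℝ) := Real.mul_self_sqrt (by norm_num)

theorem jRoot_sq : jRoot ^ 2 = -1 - jRoot := by
  have := sqrt_three_mul_self
  apply Complex.ext <;> simp [sq, jRoot_re, jRoot_im] <;> nlinarith

theorem jRoot_cube : jRoot ^ 3 = 1 := by
  linear_combination (jRoot - 1) * jRoot_sq

theorem normSq_eisenstein (a b : ℤ) :
    Complex.normSq (a + b * jRoot) = (a ^ 2 - a * b + b ^ 2 : ℤ) := by
  have := sqrt_three_mul_self
  simp only [Complex.normSq_apply, Complex.add_re, Complex.add_im, Complex.mul_re, Complex.mul_im,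
    Complex.intCast_re, Complex.intCast_im, jRoot_re, jRoot_im]
  push_cast
  linear_combination (b : ℝ) ^ 2 / 4 * this

/-- The Eisenstein integers `z ∈ ℤ[j]` that are congruent to `k` modulo the prime `1 - j`. As
`ℤ[j] / (1 - j) = 𝔽₃`, the class of `a + b j` is `a + b` modulo `3`. -/
def EisClass (k : ℤ) (z : ℂ) : Prop :=
  ∃ a b : ℤ, z = a + b * jRoot ∧ (3 : ℤ) ∣ a + b - k

namespace EisClass

variable {k l : ℤ} {z y : ℂ}

theorem zero : EisClass 0 0 := ⟨0, 0, by simp, by simp⟩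

theorem one : EisClass 1 1 := ⟨1, 0, by simp, by simp⟩

theorem j : EisClass 1 jRoot := ⟨0, 1, by simp, by simp⟩

theorem congr (h : EisClass k z) (hkl : (3 : ℤ) ∣ k - l) : EisClass l z := by
  obtain ⟨a, b, rfl, hab⟩ := h
  exact ⟨a, b, rfl, by omega⟩

theorem add (h : EisClass k z) (h' : EisClass l y) : EisClass (k + l) (z + y) := by
  obtain ⟨a, b, rfl, hab⟩ := h
  obtain ⟨c, d, rfl, hcd⟩ := h'
  exact ⟨a + c, b + d, by push_cast; ring, by omega⟩

theorem neg (h : EisClass k z) : EisClass (-k) (-z) := by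
  obtain ⟨a, b, rfl, hab⟩ := h
  exact ⟨-a, -b, by push_cast; ring, by omega⟩

theorem sub (h : EisClass k z) (h' : EisClass l y) : EisClass (k - l) (z - y) := by
  rw [sub_eq_add_neg, sub_eq_add_neg]
  exact h.add h'.neg

theorem mul (h : EisClass k z) (h' : EisClass l y) : EisClass (k * l) (z * y) := by
  obtain ⟨a, b, rfl, m, hm⟩ := h
  obtain ⟨c, d, rfl, n, hn⟩ := h'
  refine ⟨a * c - b * d, a * d + b * c - b * d, ?_, ?_⟩
  · push_cast
    linear_combination (b * d : ℂ) * jRoot_sq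
  · refine ⟨m * (c + d) + n * k - b * d, ?_⟩
    linear_combination (c + d) * hm + k * hn

theorem pow (h : EisClass k z) (n : ℕ) : EisClass (k ^ n) (z ^ n) := by
  induction n with
  | zero => simpa using one
  | succ n ih =>
    rw [pow_succ, pow_succ]
    exact ih.mul h

/-- The norm of an Eisenstein integer is an integer, congruent to the square of its class. -/
theorem exists_normSq (h : EisClass k z) : ∃ n : ℤ, Complex.normSq z = n ∧ (3 : ℤ) ∣ n - k ^ 2 := by
  obtain ⟨a, b, rfl, m, hm⟩ := h
  refine ⟨_, normSq_eisenstein a b, (a + b + k) * m - a * b, ?_⟩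
  linear_combination (a + b + k) * hm

theorem norm_ne_one (h : EisClass 0 z) : ‖z‖ ≠ 1 := by
  intro h1
  obtain ⟨n, hn, hdvd⟩ := h.exists_normSq
  rw [Complex.normSq_eq_norm_sq, h1] at hn
  have : n = 1 := by exact_mod_cast hn.symm.trans (one_pow 2)
  subst this
  norm_num at hdvd

theorem eq_of_norm_one (h : EisClass 1 z) (hz : ‖z‖ = 1) :
    z = 1 ∨ z = jRoot ∨ z = jRoot ^ 2 := by
  obtain ⟨a, b, rfl, hab⟩ := h
  have h1 := normSq_eisenstein a b
  rw [Complex.normSq_eq_norm_sq, hz, one_pow] at h1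
  have h2 : a ^ 2 - a * b + b ^ 2 = 1 := by exact_mod_cast h1.symm
  have ha : a ≤ 1 ∧ -1 ≤ a := by constructor <;> nlinarith [sq_nonneg (a - 2 * b)]
  have hb : b ≤ 1 ∧ -1 ≤ b := by constructor <;> nlinarith [sq_nonneg (b - 2 * a)]
  rw [jRoot_sq]
  obtain ⟨ha1, ha2⟩ := ha
  obtain ⟨hb1, hb2⟩ := hb
  have key : (a = 1 ∧ b = 0) ∨ (a = 0 ∧ b = 1) ∨ (a = -1 ∧ b = -1) := by
    interval_cases a <;> interval_cases b <;> omega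
  rcases key with ⟨rfl, rfl⟩ | ⟨rfl, rfl⟩ | ⟨rfl, rfl⟩
  · exact Or.inl (by push_cast; ring)
  · exact Or.inr (Or.inl (by push_cast; ring))
  · exact Or.inr (Or.inr (by push_cast; ring))

end EisClass

/-- The ideal `(1 - j)` is generated by `1 - j` and `1 - j²` as a group. -/
theorem eisenstein_induction {P : ℂ → Prop} {c : ℂ} (hc : P c)
    (h1 : ∀ z, P z → P (z + (1 - jRoot))) (h2 : ∀ z, P z → P (z - (1 - jRoot)))
    (h3 : ∀ z, P z → P (z + (1 - jRoot ^ 2))) (h4 : ∀ z, P z → P (z - (1 - jRoot ^ 2)))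
    {z : ℂ} (hz : EisClass 0 (z - c)) : P z := by
  have key : ∀ v : ℂ, (∀ z, P z → P (z + v)) → (∀ z, P z → P (z - v)) →
      ∀ (n : ℤ) z, P z → P (z + n * v) := by
    intro v hp hm n z hz
    induction n using Int.induction_on with
    | zero => simpa using hz
    | succ i ih =>
      have := hp _ ih
      rwa [add_assoc, ← add_one_mul, ← Int.cast_one (R := ℂ), ← Int.cast_add] at this
    | pred i ih =>
      have := hm _ ih
      rwa [add_sub_assoc, ← sub_one_mul, ← Int.cast_one (R := ℂ), ← Int.cast_sub] at this
  obtain ⟨a, b, hab, s, hs⟩ := hz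
  have := key _ h1 h2 (s - b) _ (key _ h3 h4 s c hc)
  convert this using 1
  have ha : (a : ℂ) = 3 * s - b := by
    have : a = 3 * s - b := by omega
    rw [this]
    push_cast
    ring
  push_cast
  linear_combination hab + ha + s * jRoot_sq

/-! ### The tiles -/

theorem reflection_span_singleton_eq {K : Submodule ℝ ℂ} [K.HasOrthogonalProjection] {u : ℂ}
    (hK : K = Submodule.span ℝ {u}) (hu : u ≠ 0) (z : ℂ) :
    K.reflection z = u / (starRingEnd ℂ) u * (starRingEnd ℂ) z := by
  subst hK
  have hu' : (starRingEnd ℂ) u ≠ 0 := (map_ne_zero _).2 hu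
  rw [Submodule.reflection_singleton_apply, Complex.inner]
  have h1 : ((((starRingEnd ℂ) u * z).re : ℝ) : ℂ)
      = ((starRingEnd ℂ) u * z + u * (starRingEnd ℂ) z) / 2 := by
    rw [Complex.re_eq_add_conj, map_mul, Complex.conj_conj]
  have h2 : ((‖u‖ ^ 2 : ℝ) : ℂ) = u * (starRingEnd ℂ) u := by
    rw [Complex.mul_conj, Complex.normSq_eq_norm_sq]
  simp only [RCLike.ofReal_real_eq_id, id_eq, Complex.real_smul, two_smul, Complex.ofReal_div]
  rw [mul_comm z, h1, h2]
  field_simp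
  ring

/-- Reflection of the complex plane in the line through `p` and `q`. -/
theorem reflection_line_eq {p q : ℂ} (hpq : p ≠ q) (z : ℂ) :
    EuclideanGeometry.reflection line[ℝ, p, q] z
      = p + (q - p) / (starRingEnd ℂ) (q - p) * (starRingEnd ℂ) (z - p) := by
  have hp : p ∈ line[ℝ, p, q] := left_mem_affineSpan_pair ℝ p q
  have hdir : (line[ℝ, p, q]).direction = Submodule.span ℝ {q - p} := by
    rw [direction_affineSpan, vectorSpan_pair_rev]
    rfl
  refine (EuclideanGeometry.reflection_apply_of_mem _ z hp).trans ?_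
  rw [reflection_span_singleton_eq hdir (sub_ne_zero.2 hpq.symm)]
  exact add_comm _ _

/-- The units `± 1, ± j, ± j²` of the Eisenstein integers, as the powers of `-j`. -/
def IsHexUnit (u : ℂ) : Prop := ∃ n : ℕ, u = (-jRoot) ^ n

theorem neg_jRoot_pow_six : (-jRoot) ^ 6 = 1 := by
  linear_combination (jRoot ^ 3 + 1) * jRoot_cube

namespace IsHexUnit

variable {u v : ℂ}

theorem one : IsHexUnit 1 := ⟨0, by simp⟩

theorem mul (hu : IsHexUnit u) (hv : IsHexUnit v) : IsHexUnit (u * v) := by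
  obtain ⟨m, rfl⟩ := hu
  obtain ⟨n, rfl⟩ := hv
  exact ⟨m + n, (pow_add _ _ _).symm⟩

theorem pow (hu : IsHexUnit u) (n : ℕ) : IsHexUnit (u ^ n) := by
  obtain ⟨m, rfl⟩ := hu
  exact ⟨m * n, (pow_mul _ _ _).symm⟩

theorem neg_j : IsHexUnit (-jRoot) := ⟨1, by simp⟩

theorem pow_six (hu : IsHexUnit u) : u ^ 6 = 1 := by
  obtain ⟨m, rfl⟩ := hu
  rw [← pow_mul, mul_comm, pow_mul, neg_jRoot_pow_six, one_pow]

theorem norm_eq (hu : IsHexUnit u) : ‖u‖ = 1 :=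
  Complex.norm_eq_one_of_pow_eq_one hu.pow_six (by norm_num)

theorem ne_zero (hu : IsHexUnit u) : u ≠ 0 := by
  intro h
  have := hu.norm_eq
  simp [h] at this

theorem conj (hu : IsHexUnit u) : (starRingEnd ℂ) u = u⁻¹ :=
  (Complex.inv_eq_conj hu.norm_eq).symm

theorem neg_one : IsHexUnit (-1) := ⟨3, by linear_combination jRoot_cube⟩

theorem neg (hu : IsHexUnit u) : IsHexUnit (-u) := by
  rw [← neg_one_mul]
  exact neg_one.mul hu

theorem j : IsHexUnit jRoot := by
  have := neg_j.neg
  rwa [neg_neg] at this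

theorem eisClass (hu : IsHexUnit u) : EisClass 1 u ∨ EisClass (-1) u := by
  obtain ⟨n, rfl⟩ := hu
  have := EisClass.j.neg.pow n
  rcases neg_one_pow_eq_or ℤ n with h | h <;> rw [h] at this
  · exact Or.inl this
  · exact Or.inr this

end IsHexUnit

/-- The two generators of the group of units; their powers run around a hexagon in the two
directions. -/
def IsHexGen (ε : ℂ) : Prop := ε = -jRoot ∨ ε = (-jRoot) ^ 5

namespace IsHexGen

variable {ε : ℂ}

theorem isHexUnit (h : IsHexGen ε) : IsHexUnit ε := by
  rcases h with rfl | rfl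
  · exact .neg_j
  · exact .pow .neg_j 5

theorem sq_eq (h : IsHexGen ε) : ε ^ 2 = ε - 1 := by
  rcases h with rfl | rfl
  · linear_combination jRoot_sq
  · linear_combination (jRoot ^ 7 + jRoot ^ 4 + jRoot + jRoot ^ 2) * jRoot_cube + jRoot_sq

theorem inv (h : IsHexGen ε) : IsHexGen ε⁻¹ := by
  have h6 := neg_jRoot_pow_six
  rcases h with rfl | rfl
  · right
    exact inv_eq_of_mul_eq_one_right (by linear_combination h6)
  · left
    exact inv_eq_of_mul_eq_one_right (by linear_combination h6)

/-- The successive units `r, r ε, …, r ε⁵` are all the units. -/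
theorem exists_mul_pow_eq (h : IsHexGen ε) {r u : ℂ} (hr : IsHexUnit r) (hu : IsHexUnit u) :
    ∃ k : Fin 6, r * ε ^ (k : ℕ) = u := by
  have key : ∀ m n p : ℕ, (-jRoot) ^ (6 * m + n + 6 * p) = (-jRoot) ^ n := by
    intro m n p
    rw [pow_add, pow_add, pow_mul, pow_mul, neg_jRoot_pow_six]
    simp
  have hmod : ∀ k : ℕ, ε ^ (k % 6) = ε ^ k := fun k =>
    (pow_eq_pow_mod k h.isHexUnit.pow_six).symm
  obtain ⟨m, rfl⟩ := hr
  obtain ⟨n, rfl⟩ := hu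
  rcases h with rfl | rfl
  · refine ⟨⟨(n + 5 * m) % 6, Nat.mod_lt _ (by norm_num)⟩, ?_⟩
    rw [hmod, ← pow_add, ← key m n 0]
    congr 1
    ring
  · refine ⟨⟨(m + 5 * n) % 6, Nat.mod_lt _ (by norm_num)⟩, ?_⟩
    rw [hmod, ← pow_mul, ← pow_add, ← key m n (4 * n)]
    congr 1
    ring

end IsHexGen

/-- The hexagon with centre `α + w c` and successive vertices `α + w (c + r εⁱ)`. -/
def hexTile (α w c r ε : ℂ) : Fin 6 → ℂ := fun i => α + w * (c + r * ε ^ (i : ℕ))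

theorem hexTile_succ {α w c r ε : ℂ} (hε : IsHexGen ε) (k : Fin 6) :
    hexTile α w c r ε (k + 1) = α + w * (c + r * (ε ^ (k : ℕ) * ε)) := by
  have : ε ^ ((k + 1 : Fin 6) : ℕ) = ε ^ (k : ℕ) * ε := by
    rw [← pow_succ, Fin.val_add, ← pow_eq_pow_mod _ hε.isHexUnit.pow_six]
    rfl
  rw [hexTile, this]

theorem fundamentalHexagon_eq (α β : ℂ) :
    fundamentalHexagon α β = hexTile α (β - α) (-jRoot) jRoot (-jRoot) := by
  have h2 := jRoot_sq
  funext i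
  fin_cases i <;> simp only [fundamentalHexagon, hexTile] <;> simp
  · linear_combination (β - α) * h2
  · linear_combination -(β - α) * jRoot_cube
  · linear_combination (β - α) * (h2 + jRoot * jRoot_cube)
  · linear_combination -(β - α) * jRoot ^ 2 * jRoot_cube
  · linear_combination (β - α) * (h2 + (jRoot ^ 3 + 1) * jRoot_cube)

/-- Reflection of a tile in its edge number `k`. -/
theorem reflection_hexTile {α w c r ε : ℂ} (hw : w ≠ 0) (hr : IsHexUnit r) (hε : IsHexGen ε)
    (k : Fin 6) :
    (fun i => EuclideanGeometry.reflection
        line[ℝ, hexTile α w c r ε k, hexTile α w c r ε (k + 1)] (hexTile α w c r ε i))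
      = hexTile α w (c + r * ε ^ (k : ℕ) * (1 + ε)) (r * ε ^ (2 * (k : ℕ) + 4)) ε⁻¹ := by
  have hr0 := hr.ne_zero
  have he0 := hε.isHexUnit.ne_zero
  have hcw : (starRingEnd ℂ) w ≠ 0 := (map_ne_zero _).2 hw
  have hsq := hε.sq_eq
  have hsub : hexTile α w c r ε (k + 1) - hexTile α w c r ε k = w * (r * ε ^ ((k : ℕ) + 2)) := by
    rw [hexTile_succ hε, hexTile]
    linear_combination -w * r * ε ^ (k : ℕ) * hsq
  have hne : hexTile α w c r ε k ≠ hexTile α w c r ε (k + 1) := by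
    intro h
    rw [h, sub_self] at hsub
    exact mul_ne_zero hw (mul_ne_zero hr0 (pow_ne_zero _ he0)) hsub.symm
  funext i
  have hsub' : hexTile α w c r ε i - hexTile α w c r ε k
      = w * (r * (ε ^ (i : ℕ) - ε ^ (k : ℕ))) := by
    rw [hexTile, hexTile]
    ring
  rw [reflection_line_eq hne, hsub, hsub', hexTile, hexTile]
  simp only [map_mul, map_sub, map_pow, hr.conj, hε.isHexUnit.conj]
  have h4 : ε ^ 4 = -ε := by linear_combination (ε ^ 2 + ε) * hsq
  have h1 : w * (r * ε ^ ((k : ℕ) + 2)) / ((starRingEnd ℂ) w * (r⁻¹ * ε⁻¹ ^ ((k : ℕ) + 2)))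
      * ((starRingEnd ℂ) w * (r⁻¹ * (ε⁻¹ ^ (i : ℕ) - ε⁻¹ ^ (k : ℕ))))
      = w * (r * ε ^ (2 * (k : ℕ) + 4) * ε⁻¹ ^ (i : ℕ) - r * ε ^ (k : ℕ) * ε ^ 4) := by
    have hk : ε⁻¹ ^ (k : ℕ) * ε ^ (k : ℕ) = 1 := by
      rw [← mul_pow, inv_mul_cancel₀ he0, one_pow]
    have hk2 : (ε⁻¹ ^ ((k : ℕ) + 2))⁻¹ = ε ^ ((k : ℕ) + 2) := by
      rw [inv_pow, inv_inv]
    rw [div_eq_mul_inv, mul_inv, mul_inv, inv_inv, hk2]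
    have hwc := mul_inv_cancel₀ hcw
    have hrr := mul_inv_cancel₀ hr0
    calc _ = w * (r * ε ^ ((k : ℕ) + 2)) * ε ^ ((k : ℕ) + 2) * (ε⁻¹ ^ (i : ℕ) - ε⁻¹ ^ (k : ℕ))
          * ((starRingEnd ℂ) w * ((starRingEnd ℂ) w)⁻¹) * (r * r⁻¹) := by ring
      _ = w * (r * ε ^ (2 * (k : ℕ) + 4) * ε⁻¹ ^ (i : ℕ)
          - r * ε ^ (k : ℕ) * ε ^ 4 * (ε⁻¹ ^ (k : ℕ) * ε ^ (k : ℕ))) := by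
        rw [hwc, hrr]
        ring
      _ = _ := by rw [hk, mul_one]
  rw [h1, h4]
  ring

/-- Every tile is centred at an Eisenstein integer of class `2`; reflection in an edge keeps the class
of the centre and reverses the orientation. -/
theorem IsTile.exists_eq {α β : ℂ} (hαβ : α ≠ β) {h : Fin 6 → ℂ} (hh : IsTile α β h) :
    ∃ c r ε, EisClass 2 c ∧ IsHexUnit r ∧ IsHexGen ε ∧ h = hexTile α (β - α) c r ε := by
  induction hh with
  | base =>
    exact ⟨_, _, _, EisClass.j.neg.congr (by norm_num), .j, Or.inl rfl, fundamentalHexagon_eq α β⟩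
  | reflect h k _ ih =>
    obtain ⟨c, r, ε, hc, hr, hε, rfl⟩ := ih
    refine ⟨_, _, _, ?_, hr.mul (hε.isHexUnit.pow _), hε.inv,
      reflection_hexTile (sub_ne_zero.2 hαβ.symm) hr hε k⟩
    have h1 : EisClass 0 (1 + ε) := by
      rcases hε with rfl | rfl
      · exact EisClass.one.add EisClass.j.neg
      · exact EisClass.one.add (EisClass.j.neg.pow 5)
    rcases (hr.mul (hε.isHexUnit.pow (k : ℕ))).eisClass with h | h
    · simpa using hc.add (h.mul h1)
    · simpa using hc.add (h.mul h1)

/-- Every possible centre is the centre of a tile: reflecting in the edges moves the centre by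
generators of the ideal `(1 - j)`. -/
theorem exists_isTile {α β : ℂ} (hαβ : α ≠ β) {c : ℂ} (hc : EisClass 2 c) :
    ∃ r ε, IsHexUnit r ∧ IsHexGen ε ∧ IsTile α β (hexTile α (β - α) c r ε) := by
  let P : ℂ → Prop := fun c =>
    ∃ r ε, IsHexUnit r ∧ IsHexGen ε ∧ IsTile α β (hexTile α (β - α) c r ε)
  have hmove : ∀ c u, IsHexUnit u → P c → P (c + u * (1 - jRoot)) := by
    rintro c u hu ⟨r, ε, hr, hε, ht⟩
    obtain ⟨u', hu', he⟩ : ∃ u', IsHexUnit u' ∧ u * (1 - jRoot) = u' * (1 + ε) := by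
      rcases hε with rfl | rfl
      · exact ⟨u, hu, by ring⟩
      · exact ⟨u * (-jRoot), hu.mul .neg_j, by linear_combination -u * neg_jRoot_pow_six⟩
    obtain ⟨k, hk⟩ := hε.exists_mul_pow_eq hr hu'
    have := IsTile.reflect _ k ht
    rw [reflection_hexTile (sub_ne_zero.2 hαβ.symm) hr hε k, hk, ← he] at this
    exact ⟨_, _, hr.mul (hε.isHexUnit.pow _), hε.inv, this⟩
  have hbase : P (-jRoot) := ⟨_, _, .j, Or.inl rfl, by
    rw [← fundamentalHexagon_eq]
    exact .base⟩
  have hcube := jRoot_cube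
  refine eisenstein_induction (P := P) hbase (fun z hz => ?_) (fun z hz => ?_) (fun z hz => ?_)
    (fun z hz => ?_) ((hc.sub EisClass.j.neg).congr (by norm_num))
  · have := hmove z 1 .one hz
    rwa [one_mul] at this
  · have := hmove z (-1) .neg_one hz
    rwa [neg_one_mul, ← sub_eq_add_neg] at this
  · have := hmove z (-jRoot ^ 2) (IsHexUnit.j.pow 2).neg hz
    convert this using 1
    linear_combination -hcube
  · have := hmove z (jRoot ^ 2) (IsHexUnit.j.pow 2) hz
    convert this using 1
    linear_combination hcube

/-! ### Vertices and edges of the tiling -/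

/-- With `w = β - α`, the vertices of the tiling are the points `α + w z` for which `z` is an
Eisenstein integer of class `0` or `1`; those of class `2` give the centres of the tiles. -/
theorem mem_hexVertices_iff {α β : ℂ} (hαβ : α ≠ β) {p : ℂ} :
    p ∈ hexVertices α β ↔ ∃ z, p = α + (β - α) * z ∧ (EisClass 0 z ∨ EisClass 1 z) := by
  constructor
  · rintro ⟨h, hh, k, rfl⟩
    obtain ⟨c, r, ε, hc, hr, hε, rfl⟩ := hh.exists_eq hαβ
    refine ⟨_, rfl, ?_⟩
    rcases (hr.mul (hε.isHexUnit.pow (k : ℕ))).eisClass with h | h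
    · exact Or.inl ((hc.add h).congr (by norm_num))
    · exact Or.inr ((hc.add h).congr (by norm_num))
  · rintro ⟨z, rfl, hz⟩
    obtain ⟨u, hu, hc⟩ : ∃ u, IsHexUnit u ∧ EisClass 2 (z - u) := by
      rcases hz with hz | hz
      · exact ⟨1, .one, (hz.sub .one).congr (by norm_num)⟩
      · exact ⟨-1, .neg_one, (hz.sub EisClass.one.neg).congr (by norm_num)⟩
    obtain ⟨r, ε, hr, hε, ht⟩ := exists_isTile hαβ hc
    obtain ⟨k, hk⟩ := hε.exists_mul_pow_eq hr hu
    refine ⟨_, ht, k, ?_⟩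
    rw [hexTile, hk]
    ring

/-- The edges at a vertex of class `0`. -/
theorem dist_eq_iff_of_class_zero {α w z z' : ℂ} (hw : w ≠ 0) (hz : EisClass 0 z)
    (hz' : EisClass 0 z' ∨ EisClass 1 z') :
    dist (α + w * z) (α + w * z') = ‖w‖ ↔ ∃ k < 3, z' = z + jRoot ^ k := by
  have hd : dist (α + w * z) (α + w * z') = ‖w‖ * ‖z' - z‖ := by
    rw [dist_comm, dist_eq_norm, ← norm_mul]
    congr 1
    ring
  rw [hd, mul_eq_left₀ (norm_ne_zero_iff.2 hw)]
  constructor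
  · intro h
    rcases hz' with hz' | hz'
    · exact absurd h (hz'.sub hz).norm_ne_one
    · rcases (hz'.sub hz).eq_of_norm_one h with h | h | h
      · exact ⟨0, by norm_num, by linear_combination h⟩
      · exact ⟨1, by norm_num, by linear_combination h⟩
      · exact ⟨2, by norm_num, by linear_combination h⟩
  · rintro ⟨k, _, rfl⟩
    rw [add_sub_cancel_left]
    exact (IsHexUnit.j.pow k).norm_eq

/-- The edges at a vertex of class `1`. -/
theorem dist_eq_iff_of_class_one {α w z z' : ℂ} (hw : w ≠ 0) (hz : EisClass 1 z)
    (hz' : EisClass 0 z' ∨ EisClass 1 z') :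
    dist (α + w * z) (α + w * z') = ‖w‖ ↔ ∃ k < 3, z' = z - jRoot ^ k := by
  have hz1 : EisClass 0 (1 - z) := EisClass.one.sub hz
  have hz2 : EisClass 0 (1 - z') ∨ EisClass 1 (1 - z') :=
    hz'.symm.imp (fun h => EisClass.one.sub h) (fun h => EisClass.one.sub h)
  -- the point reflection `z ↦ 1 - z` exchanges the two classes
  have hd : dist (α + w * z) (α + w * z') = dist (α + w * (1 - z)) (α + w * (1 - z')) := by
    rw [dist_comm, dist_eq_norm, dist_eq_norm]
    congr 1
    ring
  rw [hd, dist_eq_iff_of_class_zero hw hz1 hz2]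
  constructor
  · rintro ⟨k, hk, h⟩
    exact ⟨k, hk, by linear_combination -h⟩
  · rintro ⟨k, hk, h⟩
    exact ⟨k, hk, by linear_combination -h⟩

/-- Two vertices of the tiling are joined by an edge if and only if they have the minimal
distance. -/
theorem hexGraph_adj_iff {α β : ℂ} (hαβ : α ≠ β) {p q : hexVertices α β} :
    (hexGraph α β).Adj p q ↔ dist (p : ℂ) q = ‖β - α‖ := by
  have hw : β - α ≠ 0 := sub_ne_zero.2 hαβ.symm
  have key : ∀ h, IsTile α β h → ∀ k, dist (h k) (h (k + 1)) = ‖β - α‖ := by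
    intro h hh k
    obtain ⟨c, r, ε, hc, hr, hε, rfl⟩ := hh.exists_eq hαβ
    rw [dist_comm, dist_eq_norm, hexTile_succ hε, hexTile]
    have : α + (β - α) * (c + r * (ε ^ (k : ℕ) * ε)) - (α + (β - α) * (c + r * ε ^ (k : ℕ)))
        = (β - α) * (r * ε ^ ((k : ℕ) + 2)) := by
      linear_combination -(β - α) * r * ε ^ (k : ℕ) * hε.sq_eq
    rw [this, norm_mul, (hr.mul (hε.isHexUnit.pow _)).norm_eq, mul_one]
  have hadj : ∀ z z', EisClass 0 z → (EisClass 0 z' ∨ EisClass 1 z') →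
      dist (α + (β - α) * z) (α + (β - α) * z') = ‖β - α‖ →
      ∃ h, IsTile α β h ∧ ∃ k, (h k = α + (β - α) * z ∧ h (k + 1) = α + (β - α) * z') ∨
        (h k = α + (β - α) * z' ∧ h (k + 1) = α + (β - α) * z) := by
    intro z z' hz hz' hd
    obtain ⟨m, -, rfl⟩ := (dist_eq_iff_of_class_zero hw hz hz').1 hd
    have hu := IsHexUnit.j.pow m
    have hc : EisClass 2 (z - jRoot * jRoot ^ m) := by
      have := hz.sub (EisClass.j.mul (EisClass.j.pow m))
      rw [one_pow] at this
      exact this.congr (by norm_num)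
    obtain ⟨r, ε, hr, hε, ht⟩ := exists_isTile hαβ hc
    refine ⟨_, ht, ?_⟩
    rcases hε with rfl | rfl
    · obtain ⟨k, hk⟩ := IsHexGen.exists_mul_pow_eq (Or.inl rfl) hr (IsHexUnit.j.mul hu)
      refine ⟨k, Or.inl ⟨?_, ?_⟩⟩
      · rw [hexTile, hk]
        ring
      · rw [hexTile_succ (Or.inl rfl), ← mul_assoc r, hk]
        linear_combination -(β - α) * jRoot ^ m * jRoot_sq
    · obtain ⟨k, hk⟩ := IsHexGen.exists_mul_pow_eq (Or.inr rfl) hr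
        ((IsHexUnit.j.pow 2).mul hu).neg
      refine ⟨k, Or.inr ⟨?_, ?_⟩⟩
      · rw [hexTile, hk]
        linear_combination -(β - α) * jRoot ^ m * jRoot_sq
      · rw [hexTile_succ (Or.inr rfl), ← mul_assoc r, hk]
        linear_combination (β - α) * jRoot ^ m * jRoot * (jRoot ^ 3 + 1) * jRoot_cube
  rw [hexGraph, SimpleGraph.fromRel_adj]
  constructor
  · rintro ⟨-, ⟨h, hh, k, h1, h2⟩ | ⟨h, hh, k, h1, h2⟩⟩
    · rw [← h1, ← h2]
      exact key h hh k
    · rw [← h1, ← h2, dist_comm]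
      exact key h hh k
  · intro hd
    refine ⟨?_, ?_⟩
    · rintro rfl
      rw [dist_self] at hd
      exact hw (norm_eq_zero.1 hd.symm)
    obtain ⟨z, hpz, hz⟩ := (mem_hexVertices_iff hαβ).1 p.2
    obtain ⟨z', hqz, hz'⟩ := (mem_hexVertices_iff hαβ).1 q.2
    rw [hpz, hqz] at hd ⊢
    rcases hz with hz | hz
    · obtain ⟨h, hh, k, h1 | h1⟩ := hadj z z' hz hz' hd
      · exact Or.inl ⟨h, hh, k, h1⟩
      · exact Or.inr ⟨h, hh, k, h1⟩
    · have hz0 : EisClass 0 z' := by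
        obtain ⟨m, -, rfl⟩ := (dist_eq_iff_of_class_one hw hz hz').1 hd
        simpa using hz.sub (EisClass.j.pow m)
      rw [dist_comm] at hd
      obtain ⟨h, hh, k, h1 | h1⟩ := hadj z' z hz0 (Or.inr hz) hd
      · exact Or.inr ⟨h, hh, k, h1⟩
      · exact Or.inl ⟨h, hh, k, h1⟩

/-! ### Holomorphic functions are coverings of the tiling -/

/-- The neighbours of a point in the tiling: the vertices at minimal distance. -/
def hexStar (α β p : ℂ) : Set ℂ := {q | q ∈ hexVertices α β ∧ dist p q = ‖β - α‖}

theorem jRoot_ne_one : jRoot ≠ 1 := by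
  intro h
  have := congrArg Complex.re h
  rw [jRoot_re] at this
  norm_num at this

theorem jRoot_pow_mod (n : ℕ) : jRoot ^ (n % 3) = jRoot ^ n := (pow_eq_pow_mod n jRoot_cube).symm

theorem jRoot_pow_injective {d : ℂ} (hd : d ≠ 0) :
    d ≠ jRoot * d ∧ d ≠ jRoot ^ 2 * d ∧ jRoot * d ≠ jRoot ^ 2 * d := by
  have h0 := IsHexUnit.j.ne_zero
  have h1 := jRoot_ne_one
  refine ⟨fun h => h1 (mul_right_cancel₀ hd (by linear_combination -h)), fun h => h1 ?_,
    fun h => h1 (mul_left_cancel₀ h0 (mul_right_cancel₀ hd (by linear_combination -h)))⟩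
  exact mul_right_cancel₀ hd (by linear_combination jRoot * h + d * jRoot_cube)

/-- Three numbers whose sum and whose sum of squares vanish are `d, j d, j² d`. -/
theorem eq_mul_jRoot_of_sum_eq_zero {d e f : ℂ} (h1 : d + e + f = 0)
    (h2 : d ^ 2 + e ^ 2 + f ^ 2 = 0) :
    (e = jRoot * d ∧ f = jRoot ^ 2 * d) ∨ (f = jRoot * d ∧ e = jRoot ^ 2 * d) := by
  have hj := jRoot_sq
  have h3 : (e - jRoot * d) * (e - jRoot ^ 2 * d) = 0 := by
    linear_combination (1 / 2 : ℂ) * h2 + (1 / 2 : ℂ) * (d + e - f) * h1 - e * d * hj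
      + d ^ 2 * jRoot_cube
  rcases mul_eq_zero.1 h3 with h | h
  · left
    exact ⟨by linear_combination h, by linear_combination h1 - h - d * hj⟩
  · right
    exact ⟨by linear_combination h1 - h - d * hj, by linear_combination h⟩

section Hol

variable {V : Type u} {G : SimpleGraph V} [G.LocallyFinite]

theorem exists_neighborFinset_eq (h3 : G.IsRegularOfDegree 3) {x y : V} (h : G.Adj x y) :
    ∃ p q, y ≠ p ∧ y ≠ q ∧ p ≠ q ∧ ∀ v, v ∈ G.neighborFinset x ↔ v = y ∨ v = p ∨ v = q := by
  classical
  have hy : y ∈ G.neighborFinset x := by rwa [SimpleGraph.mem_neighborFinset]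
  have hc : ((G.neighborFinset x).erase y).card = 2 := by
    rw [Finset.card_erase_of_mem hy, SimpleGraph.card_neighborFinset_eq_degree, h3 x]
  obtain ⟨p, q, hpq, he⟩ := Finset.card_eq_two.1 hc
  have hp : p ∈ (G.neighborFinset x).erase y := by simp [he]
  have hq : q ∈ (G.neighborFinset x).erase y := by simp [he]
  refine ⟨p, q, (Finset.ne_of_mem_erase hp).symm, (Finset.ne_of_mem_erase hq).symm, hpq,
    fun v => ?_⟩
  rw [← Finset.insert_erase hy, he]
  simp

/-- At each vertex, the increments of a holomorphic function along the three edges are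
`d, j d, j² d`. -/
theorem IsHolomorphic.exists_neighbors (h3 : G.IsRegularOfDegree 3) {φ : V → ℂ}
    (hφ : IsHolomorphic G φ) {x y : V} (h : G.Adj x y) :
    ∃ p q, y ≠ p ∧ y ≠ q ∧ p ≠ q ∧ (∀ v, G.Adj x v ↔ v = y ∨ v = p ∨ v = q) ∧
      φ p - φ x = jRoot * (φ y - φ x) ∧ φ q - φ x = jRoot ^ 2 * (φ y - φ x) := by
  classical
  obtain ⟨p, q, hyp, hyq, hpq, hv⟩ := exists_neighborFinset_eq h3 h
  have hN : G.neighborFinset x = {y, p, q} := by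
    ext v
    rw [hv]
    simp
  have hsum : ∀ f : V → ℂ, laplacian G f x = 0 →
      (f y - f x) + (f p - f x) + (f q - f x) = 0 := by
    intro f hf
    rw [laplacian, h3 x, mul_eq_zero, hN] at hf
    rcases hf with hf | hf
    · norm_num at hf
    · rw [Finset.sum_insert (by simp [hyp, hyq]), Finset.sum_pair hpq] at hf
      rw [← hf]
      ring
  have h1 := hsum φ (hφ.1 x)
  have h2 := hsum _ (hφ.2 x)
  simp only [SimpleGraph.mem_neighborFinset] at hv
  rcases eq_mul_jRoot_of_sum_eq_zero h1
    (by linear_combination h2 - 2 * φ x * h1) with ⟨h4, h5⟩ | ⟨h4, h5⟩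
  · exact ⟨p, q, hyp, hyq, hpq, hv, h4, h5⟩
  · exact ⟨q, p, hyq, hyp, hpq.symm, fun v => by rw [hv, or_comm (a := v = p)], h4, h5⟩

theorem IsHolomorphic.exists_adj_sub_eq (h3 : G.IsRegularOfDegree 3) {φ : V → ℂ}
    (hφ : IsHolomorphic G φ) {x y : V} (h : G.Adj x y) (l : ℕ) :
    ∃ v, G.Adj x v ∧ φ v - φ x = jRoot ^ l * (φ y - φ x) := by
  obtain ⟨p, q, -, -, -, hv, hp, hq⟩ := hφ.exists_neighbors h3 h
  rw [← jRoot_pow_mod]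
  have : l % 3 < 3 := Nat.mod_lt _ (by norm_num)
  interval_cases l % 3
  · exact ⟨y, h, by ring⟩
  · exact ⟨p, (hv p).2 (by simp), by rw [hp, pow_one]⟩
  · exact ⟨q, (hv q).2 (by simp), hq⟩

theorem IsHolomorphic.exists_sub_eq_of_adj (h3 : G.IsRegularOfDegree 3) {φ : V → ℂ}
    (hφ : IsHolomorphic G φ) {x y v : V} (h : G.Adj x y) (hxv : G.Adj x v) :
    ∃ l, φ v - φ x = jRoot ^ l * (φ y - φ x) := by
  obtain ⟨p, q, -, -, -, hv, hp, hq⟩ := hφ.exists_neighbors h3 h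
  rcases (hv v).1 hxv with rfl | rfl | rfl
  · exact ⟨0, by ring⟩
  · exact ⟨1, by rw [hp, pow_one]⟩
  · exact ⟨2, hq⟩

/-- If a holomorphic function is constant on one edge it is constant. -/
theorem IsHolomorphic.ne_of_adj (hG : G.Connected) (h3 : G.IsRegularOfDegree 3) {φ : V → ℂ}
    (hφ : IsHolomorphic G φ) (hne : ∃ x y, φ x ≠ φ y) {a b : V} (hab : G.Adj a b) :
    φ a ≠ φ b := by
  intro h
  have key : ∀ x, φ x = φ a ∧ ∀ y, G.Adj x y → φ y = φ x := by
    have hstep : ∀ x y, G.Adj x y → φ x = φ y → ∀ v, G.Adj x v → φ v = φ x := by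
      intro x y hxy he v hv
      obtain ⟨l, hl⟩ := hφ.exists_sub_eq_of_adj h3 hxy hv
      rwa [he, sub_self, mul_zero, sub_eq_zero, ← he] at hl
    refine connected_induction hG a ⟨rfl, hstep a b hab h⟩ ?_
    rintro x y hxy ⟨h1, h2⟩
    exact ⟨(h2 y hxy).trans h1, hstep y x hxy.symm (h2 y hxy)⟩
  obtain ⟨x, y, hxy⟩ := hne
  exact hxy ((key x).1.trans (key y).1.symm)

theorem IsHolomorphic.injOn_neighborSet (hG : G.Connected) (h3 : G.IsRegularOfDegree 3)
    {φ : V → ℂ} (hφ : IsHolomorphic G φ) (hne : ∃ x y, φ x ≠ φ y) (x : V) :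
    InjOn φ (G.neighborSet x) := by
  intro y hy z hz hyz
  by_contra hne'
  obtain ⟨p, q, -, -, -, hv, hp, hq⟩ := hφ.exists_neighbors h3 hy
  have hd : φ y - φ x ≠ 0 := sub_ne_zero.2 (hφ.ne_of_adj hG h3 hne hy).symm
  obtain ⟨h1, h2, -⟩ := jRoot_pow_injective hd
  rcases (hv z).1 hz with rfl | rfl | rfl
  · exact hne' rfl
  · exact h1 (by rw [← hp, hyz])
  · exact h2 (by rw [← hq, hyz])

/-- A non-constant holomorphic function takes values in the vertices of the tiling generated by the
values on an edge, with increments `w jᵏ` at the vertices of class `0` and `- w jᵏ` at those of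
class `1`. -/
theorem IsHolomorphic.exists_class (hG : G.Connected) (h3 : G.IsRegularOfDegree 3) {φ : V → ℂ}
    (hφ : IsHolomorphic G φ) {a b : V} (hab : G.Adj a b) (x : V) :
    (∃ z, φ x = φ a + (φ b - φ a) * z ∧ EisClass 0 z ∧
      ∀ v, G.Adj x v → ∃ k, φ v = φ a + (φ b - φ a) * (z + jRoot ^ k)) ∨
    (∃ z, φ x = φ a + (φ b - φ a) * z ∧ EisClass 1 z ∧
      ∀ v, G.Adj x v → ∃ k, φ v = φ a + (φ b - φ a) * (z - jRoot ^ k)) := by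
  have hcls : ∀ k, EisClass 1 (jRoot ^ k) := fun k => by
    have := EisClass.j.pow k
    rwa [one_pow] at this
  revert x
  refine connected_induction hG a ?_ ?_
  · refine Or.inl ⟨0, by ring, .zero, fun v hv => ?_⟩
    obtain ⟨k, hk⟩ := hφ.exists_sub_eq_of_adj h3 hab hv
    exact ⟨k, by linear_combination hk⟩
  · rintro x y hxy (⟨z, hx, hz, hv⟩ | ⟨z, hx, hz, hv⟩)
    · obtain ⟨k, hk⟩ := hv y hxy
      refine Or.inr ⟨_, hk, by simpa using hz.add (hcls k), fun v hv => ?_⟩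
      obtain ⟨m, hm⟩ := hφ.exists_sub_eq_of_adj h3 hxy.symm hv
      exact ⟨m + k, by rw [pow_add]; linear_combination hm + jRoot ^ m * hx +
        (1 - jRoot ^ m) * hk⟩
    · obtain ⟨k, hk⟩ := hv y hxy
      refine Or.inl ⟨_, hk, by simpa using hz.sub (hcls k), fun v hv => ?_⟩
      obtain ⟨m, hm⟩ := hφ.exists_sub_eq_of_adj h3 hxy.symm hv
      exact ⟨m + k, by rw [pow_add]; linear_combination hm + jRoot ^ m * hx +
        (1 - jRoot ^ m) * hk⟩

theorem IsHolomorphic.mem_hexVertices (hG : G.Connected) (h3 : G.IsRegularOfDegree 3) {φ : V → ℂ}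
    (hφ : IsHolomorphic G φ) {a b : V} (hab : G.Adj a b) (hne : φ a ≠ φ b) (x : V) :
    φ x ∈ hexVertices (φ a) (φ b) := by
  rw [mem_hexVertices_iff hne]
  rcases hφ.exists_class hG h3 hab x with ⟨z, hx, hz, -⟩ | ⟨z, hx, hz, -⟩
  · exact ⟨z, hx, Or.inl hz⟩
  · exact ⟨z, hx, Or.inr hz⟩

/-- A non-constant holomorphic function is a covering of the tiling generated by its values on an
edge. -/
theorem IsHolomorphic.isStarCover (hG : G.Connected) (h3 : G.IsRegularOfDegree 3) {φ : V → ℂ}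
    (hφ : IsHolomorphic G φ) {a b : V} (hab : G.Adj a b) (hne : φ a ≠ φ b) :
    IsStarCover G (hexStar (φ a) (φ b)) φ := by
  have hw : φ b - φ a ≠ 0 := sub_ne_zero.2 hne.symm
  have hadd : ∀ k m : ℕ, jRoot ^ (k + 2 * m) * jRoot ^ m = jRoot ^ k := by
    intro k m
    rw [← pow_add, add_assoc, ← Nat.succ_mul, pow_add, pow_mul, jRoot_cube, one_pow, mul_one]
  intro x
  obtain ⟨y, hy⟩ : ∃ y, G.Adj x y := by
    have : 0 < G.degree x := by
      rw [h3 x]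
      norm_num
    exact (G.degree_pos_iff_exists_adj x).1 this
  refine ⟨fun v hv => ⟨hφ.mem_hexVertices hG h3 hab hne v, ?_⟩,
    hφ.injOn_neighborSet hG h3 ⟨a, b, hne⟩ x, ?_⟩
  · rcases hφ.exists_class hG h3 hab x with ⟨z, hx, hz, h⟩ | ⟨z, hx, hz, h⟩
    all_goals
      obtain ⟨k, hk⟩ := h v hv
      rw [hx, hk, dist_comm, dist_eq_norm]
    · rw [show φ a + (φ b - φ a) * (z + jRoot ^ k) - (φ a + (φ b - φ a) * z)
        = (φ b - φ a) * jRoot ^ k by ring, norm_mul, (IsHexUnit.j.pow k).norm_eq, mul_one]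
    · rw [show φ a + (φ b - φ a) * (z - jRoot ^ k) - (φ a + (φ b - φ a) * z)
        = (φ b - φ a) * -jRoot ^ k by ring, norm_mul, (IsHexUnit.j.pow k).neg.norm_eq, mul_one]
  · rintro q ⟨hq, hd⟩
    obtain ⟨z', rfl, hz'⟩ := (mem_hexVertices_iff hne).1 hq
    rcases hφ.exists_class hG h3 hab x with ⟨z, hx, hz, h⟩ | ⟨z, hx, hz, h⟩
    all_goals
      rw [hx] at hd
      obtain ⟨m, hm⟩ := h y hy
    · obtain ⟨k, -, rfl⟩ := (dist_eq_iff_of_class_zero hw hz hz').1 hd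
      obtain ⟨v, hv, hv'⟩ := hφ.exists_adj_sub_eq h3 hy (k + 2 * m)
      refine ⟨v, hv, ?_⟩
      linear_combination hv' + jRoot ^ (k + 2 * m) * hm + (1 - jRoot ^ (k + 2 * m)) * hx
        + (φ b - φ a) * hadd k m
    · obtain ⟨k, -, rfl⟩ := (dist_eq_iff_of_class_one hw hz hz').1 hd
      obtain ⟨v, hv, hv'⟩ := hφ.exists_adj_sub_eq h3 hy (k + 2 * m)
      refine ⟨v, hv, ?_⟩
      linear_combination hv' + jRoot ^ (k + 2 * m) * hm + (1 - jRoot ^ (k + 2 * m)) * hx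
        - (φ b - φ a) * hadd k m

/-- By the covering property the range is closed under passing to neighbours in the tiling, and the
tiling is connected. -/
theorem IsHolomorphic.range_eq (hG : G.Connected) (h3 : G.IsRegularOfDegree 3) {φ : V → ℂ}
    (hφ : IsHolomorphic G φ) {a b : V} (hab : G.Adj a b) (hne : φ a ≠ φ b) :
    range φ = hexVertices (φ a) (φ b) := by
  have hw : φ b - φ a ≠ 0 := sub_ne_zero.2 hne.symm
  refine Subset.antisymm (range_subset_iff.2 (hφ.mem_hexVertices hG h3 hab hne)) ?_
  let R : ℂ → Prop := fun z => φ a + (φ b - φ a) * z ∈ range φ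
  have hcls : ∀ k, EisClass 1 (jRoot ^ k) := fun k => by
    have := EisClass.j.pow k
    rwa [one_pow] at this
  have hlift : ∀ z z', R z → (EisClass 0 z' ∨ EisClass 1 z') →
      dist (φ a + (φ b - φ a) * z) (φ a + (φ b - φ a) * z') = ‖φ b - φ a‖ → R z' := by
    rintro z z' ⟨x, hx⟩ hz' hd
    rw [← hx] at hd
    obtain ⟨v, -, hv⟩ := (hφ.isStarCover hG h3 hab hne x).surjOn
      ⟨(mem_hexVertices_iff hne).2 ⟨z', rfl, hz'⟩, hd⟩
    exact ⟨v, hv⟩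
  have hzero : ∀ z k, k < 3 → EisClass 0 z → R z → R (z + jRoot ^ k) := by
    intro z k hk hz h
    have hz' := Or.inr (a := EisClass 0 (z + jRoot ^ k)) (by simpa using hz.add (hcls k))
    exact hlift z _ h hz' ((dist_eq_iff_of_class_zero hw hz hz').2 ⟨k, hk, rfl⟩)
  have hone : ∀ z k, k < 3 → EisClass 1 z → R z → R (z - jRoot ^ k) := by
    intro z k hk hz h
    have hz' := Or.inl (b := EisClass 1 (z - jRoot ^ k)) (by simpa using hz.sub (hcls k))
    exact hlift z _ h hz' ((dist_eq_iff_of_class_one hw hz hz').2 ⟨k, hk, rfl⟩)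
  have hmove : ∀ z k l, k < 3 → l < 3 → EisClass 0 z ∧ R z →
      EisClass 0 (z + (jRoot ^ k - jRoot ^ l)) ∧ R (z + (jRoot ^ k - jRoot ^ l)) := by
    rintro z k l hk hl ⟨hz, h⟩
    refine ⟨by simpa using hz.add ((hcls k).sub (hcls l)), ?_⟩
    rw [← add_sub_assoc]
    exact hone _ l hl (by simpa using hz.add (hcls k)) (hzero z k hk hz h)
  have hall : ∀ z, EisClass 0 z → R z := by
    intro z hz
    refine (eisenstein_induction (P := fun z => EisClass 0 z ∧ R z) (c := 0)
      ⟨.zero, a, by ring⟩ (fun z h => ?_) (fun z h => ?_) (fun z h => ?_) (fun z h => ?_)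
      (z := z) (by simpa using hz)).2
    · simpa using hmove z 0 1 (by norm_num) (by norm_num) h
    · have := hmove z 1 0 (by norm_num) (by norm_num) h
      rwa [← neg_sub, ← sub_eq_add_neg, pow_zero, pow_one] at this
    · simpa using hmove z 0 2 (by norm_num) (by norm_num) h
    · have := hmove z 2 0 (by norm_num) (by norm_num) h
      rwa [← neg_sub, ← sub_eq_add_neg, pow_zero] at this
  intro p hp
  obtain ⟨z, rfl, hz | hz⟩ := (mem_hexVertices_iff hne).1 hp
  · exact hall z hz
  · have h0 : EisClass 0 (z - 1) := by simpa using hz.sub .one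
    have := hzero (z - 1) 0 (by norm_num) h0 (hall _ h0)
    rwa [pow_zero, sub_add_cancel] at this

/-- A non-constant holomorphic function as a map to the graph of the tiling. -/
theorem IsHolomorphic.exists_hom (hT : G.IsTree) (h3 : G.IsRegularOfDegree 3) {φ : V → ℂ}
    (hφ : IsHolomorphic G φ) {a b : V} (hab : G.Adj a b) (hne : φ a ≠ φ b) :
    ∃ f : G →g hexGraph (φ a) (φ b), (∀ x, (f x : ℂ) = φ x) ∧ IsUniversalCovering f := by
  have hc := hφ.isStarCover hT.1 h3 hab hne
  have hmem := hφ.mem_hexVertices hT.1 h3 hab hne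
  let f : G →g hexGraph (φ a) (φ b) :=
    ⟨fun x => ⟨φ x, hmem x⟩, fun {x y} h => (hexGraph_adj_iff hne).2 ((hc x).mapsTo h).2⟩
  refine ⟨f, fun _ => rfl, hT, ?_, fun x => ⟨fun y h => f.map_rel h, ?_, ?_⟩⟩
  · rintro ⟨p, hp⟩
    rw [← hφ.range_eq hT.1 h3 hab hne] at hp
    obtain ⟨x, rfl⟩ := hp
    exact ⟨x, rfl⟩
  · intro y hy z hz h
    exact (hc x).injOn hy hz (congrArg Subtype.val h)
  · intro q hq
    obtain ⟨y, hy, hyq⟩ := (hc x).surjOn ⟨q.2, (hexGraph_adj_iff hne).1 hq⟩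
    exact ⟨y, hy, Subtype.ext hyq⟩

/-! ### Local injectivity and conformality -/

theorem IsHolomorphic.isLocallyInjective (hG : G.Connected) (h3 : G.IsRegularOfDegree 3)
    {φ : V → ℂ} (hφ : IsHolomorphic G φ) (hne : ∃ x y, φ x ≠ φ y) : IsLocallyInjective G φ := by
  have key : ∀ x y, G.dist x y ≤ 1 → y = x ∨ G.Adj x y := by
    intro x y h
    rcases Nat.le_one_iff_eq_zero_or_eq_one.1 h with h | h
    · exact Or.inl (hG.dist_eq_zero_iff.1 h).symm
    · exact Or.inr (SimpleGraph.dist_eq_one_iff_adj.1 h)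
  intro x y hy z hz h
  rcases key x y hy with hy | hy <;> rcases key x z hz with hz | hz
  · exact hy.trans hz.symm
  · rw [hy] at h
    exact absurd h (hφ.ne_of_adj hG h3 hne hz)
  · rw [hz] at h
    exact absurd h.symm (hφ.ne_of_adj hG h3 hne hy)
  · exact hφ.injOn_neighborSet hG h3 hne x hy hz h

theorem angle_jRoot_mul {d : ℂ} (hd : d ≠ 0) :
    InnerProductGeometry.angle d (jRoot * d) = 2 * Real.pi / 3 := by
  have hn : ‖d‖ ≠ 0 := norm_ne_zero_iff.2 hd
  rw [InnerProductGeometry.angle, norm_mul, IsHexUnit.j.norm_eq, one_mul, Complex.inner]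
  have h1 : (jRoot * d * (starRingEnd ℂ) d).re = -(1 / 2) * (‖d‖ * ‖d‖) := by
    rw [mul_assoc, Complex.mul_conj, Complex.re_mul_ofReal, jRoot_re, Complex.normSq_eq_norm_sq, sq]
  rw [h1, mul_div_assoc, div_self (mul_ne_zero hn hn), mul_one, Real.arccos_neg,
    ← Real.cos_pi_div_three, Real.arccos_cos (by positivity) (by linarith [Real.pi_pos])]
  ring

theorem IsHolomorphic.isConformal (hG : G.Connected) (h3 : G.IsRegularOfDegree 3)
    {φ : V → ℂ} (hφ : IsHolomorphic G φ) (hne : ∃ x y, φ x ≠ φ y) : IsConformal G φ := by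
  intro x y z hy hz hyz
  have hd : φ y - φ x ≠ 0 := sub_ne_zero.2 (hφ.ne_of_adj hG h3 hne hy).symm
  obtain ⟨p, q, -, -, -, hv, hp, hq⟩ := hφ.exists_neighbors h3 hy
  have hpos : 0 < dist (φ x) (φ y) := dist_pos.2 (hφ.ne_of_adj hG h3 hne hy)
  rw [dist_comm _ (φ y), dist_comm _ (φ z), dist_eq_norm, dist_eq_norm,
    EuclideanGeometry.angle, vsub_eq_sub, vsub_eq_sub]
  rw [dist_comm, dist_eq_norm] at hpos
  refine ⟨hpos, ?_⟩
  rcases (hv z).1 hz with rfl | rfl | rfl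
  · exact absurd rfl hyz
  · rw [hp, angle_jRoot_mul hd, norm_mul, IsHexUnit.j.norm_eq, one_mul]
    exact ⟨rfl, rfl⟩
  · rw [hq, norm_mul, (IsHexUnit.j.pow 2).norm_eq, one_mul, InnerProductGeometry.angle_comm]
    refine ⟨rfl, ?_⟩
    have h := angle_jRoot_mul (mul_ne_zero (IsHexUnit.j.pow 2).ne_zero hd)
    rwa [← mul_assoc, ← pow_succ', jRoot_cube, one_mul] at h

end Hol

section Hol

variable {V : Type u} {G : SimpleGraph V} [G.LocallyFinite]

/-! ### Existence of holomorphic functions -/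

/-- There is a holomorphic function with prescribed values on an edge. It is defined recursively,
from `a` outwards: each vertex `x` carries the value `z`, a neighbour `p` (the one towards `a`)
and the increment `u` from `x` to `p`; the other two increments are `j u` and `j² u`. -/
theorem exists_isHolomorphic (hT : G.IsTree) (h3 : G.IsRegularOfDegree 3) {a b : V}
    (hab : G.Adj a b) (α β : ℂ) : ∃ φ : V → ℂ, IsHolomorphic G φ ∧ φ a = α ∧ φ b = β := by
  classical
  have hlab : ∀ x p, ∃ l : V → ℕ, G.Adj x p → l p = 0 ∧
      ∀ f : ℕ → ℂ, ∑ y ∈ G.neighborFinset x, f (l y) = f 0 + f 1 + f 2 := by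
    intro x p
    by_cases h : G.Adj x p
    · obtain ⟨q, r, hpq, hpr, hqr, hv⟩ := exists_neighborFinset_eq h3 h
      have hN : G.neighborFinset x = {p, q, r} := by
        ext v
        rw [hv]
        simp
      refine ⟨fun v => if v = p then 0 else if v = q then 1 else 2, fun _ => ⟨by simp, ?_⟩⟩
      intro f
      rw [hN, Finset.sum_insert (by simp [hpq, hpr]), Finset.sum_pair hqr]
      simp [hpq.symm, hpr.symm, hqr.symm, add_assoc]
    · exact ⟨fun _ => 0, fun h' => absurd h' h⟩
  choose l hl using hlab
  obtain ⟨σ, hσa, hσ⟩ := exists_tree_recursion hT a ((α, β - α, b) : ℂ × ℂ × V)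
    (fun x y s => (s.1 + s.2.1 * jRoot ^ l x s.2.2 y, -(s.2.1 * jRoot ^ l x s.2.2 y), x))
  have hp : ∀ x, G.Adj x (σ x).2.2 := by
    intro x
    by_cases hx : x = a
    · rw [hx, hσa]
      exact hab
    · obtain ⟨y, hy, hd⟩ := exists_adj_dist_succ hT.1 hx
      rw [hσ y x hy hd]
      exact hy.symm
  have hadj : ∀ x y, G.Adj x y →
      (σ y).1 = (σ x).1 + (σ x).2.1 * jRoot ^ l x (σ x).2.2 y := by
    intro x y hxy
    rcases hT.dist_eq_dist_add_one_of_adj a hxy with h | h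
    · have h1 := hσ y x hxy.symm h
      have h2 : (σ x).2.2 = y := by rw [h1]
      have h3 := (hl x (σ x).2.2 (hp x)).1
      rw [h2] at h3
      rw [h2, h3, h1]
      simp
    · rw [hσ x y hxy h]
  have hj : 1 + jRoot + jRoot ^ 2 = 0 := by linear_combination jRoot_sq
  refine ⟨fun x => (σ x).1, ⟨fun x => ?_, fun x => ?_⟩, by simp [hσa], ?_⟩
  · have h1 : ∑ y ∈ G.neighborFinset x, ((σ y).1 - (σ x).1)
        = ∑ y ∈ G.neighborFinset x, (σ x).2.1 * jRoot ^ l x (σ x).2.2 y := by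
      refine Finset.sum_congr rfl fun y hy => ?_
      rw [SimpleGraph.mem_neighborFinset] at hy
      rw [hadj x y hy]
      ring
    rw [laplacian, h1, (hl x _ (hp x)).2 (fun k => (σ x).2.1 * jRoot ^ k)]
    linear_combination (G.degree x : ℂ)⁻¹ * (σ x).2.1 * hj
  · have h1 : ∑ y ∈ G.neighborFinset x, ((σ y).1 ^ 2 - (σ x).1 ^ 2)
        = ∑ y ∈ G.neighborFinset x, (2 * (σ x).1 * ((σ x).2.1 * jRoot ^ l x (σ x).2.2 y)
          + ((σ x).2.1 * jRoot ^ l x (σ x).2.2 y) ^ 2) := by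
      refine Finset.sum_congr rfl fun y hy => ?_
      rw [SimpleGraph.mem_neighborFinset] at hy
      rw [hadj x y hy]
      ring
    rw [laplacian, h1, (hl x _ (hp x)).2
      (fun k => 2 * (σ x).1 * ((σ x).2.1 * jRoot ^ k) + ((σ x).2.1 * jRoot ^ k) ^ 2)]
    linear_combination (G.degree x : ℂ)⁻¹ * (2 * (σ x).1 * (σ x).2.1 + (σ x).2.1 ^ 2) * hj
      + (G.degree x : ℂ)⁻¹ * (σ x).2.1 ^ 2 * jRoot * jRoot_cube
  · have h1 := hadj a b hab
    have h2 := (hl a b hab).1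
    simp only [hσa, h2, pow_zero] at h1
    simp only [h1]
    ring

/-! ### Rays -/

/-- The walk that starts with the edge from `x` to `y` and turns at its `n`-th vertex according to
the factor `jᵏ`, `k = e n`, between the increments backwards and forwards. -/
theorem IsHolomorphic.exists_walk_turning (h3 : G.IsRegularOfDegree 3) {φ : V → ℂ}
    (hφ : IsHolomorphic G φ) {x y : V} (hxy : G.Adj x y) (e : ℕ → ℕ) :
    ∃ S : ℕ → V, S 0 = x ∧ S 1 = y ∧ (∀ n, G.Adj (S n) (S (n + 1))) ∧
      ∀ n, φ (S (n + 2)) - φ (S (n + 1)) = jRoot ^ e n * (φ (S n) - φ (S (n + 1))) := by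
  choose next hnext using fun (d : {d : V × V // G.Adj d.1 d.2}) (l : ℕ) =>
    hφ.exists_adj_sub_eq h3 d.2.symm l
  let T : ℕ → {d : V × V // G.Adj d.1 d.2} := fun n =>
    Nat.rec ⟨(x, y), hxy⟩ (fun n d => ⟨(d.1.2, next d (e n)), (hnext d (e n)).1⟩) n
  exact ⟨fun n => (T n).1.1, rfl, rfl, fun n => (T n).2, fun n => (hnext (T n) (e n)).2⟩

theorem IsHolomorphic.nonbacktracking_of_turning (hG : G.Connected) (h3 : G.IsRegularOfDegree 3)
    {φ : V → ℂ} (hφ : IsHolomorphic G φ) (hne : ∃ x y, φ x ≠ φ y) {e : ℕ → ℕ}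
    (he : ∀ n, e n = 1 ∨ e n = 2) {S : ℕ → V} (hS : ∀ n, G.Adj (S n) (S (n + 1)))
    (h : ∀ n, φ (S (n + 2)) - φ (S (n + 1)) = jRoot ^ e n * (φ (S n) - φ (S (n + 1)))) (n : ℕ) :
    S (n + 2) ≠ S n := by
  intro heq
  have h1 := h n
  rw [heq] at h1
  have hd : φ (S n) - φ (S (n + 1)) ≠ 0 := sub_ne_zero.2 (hφ.ne_of_adj hG h3 hne (hS n))
  obtain ⟨h4, h5, -⟩ := jRoot_pow_injective hd
  rcases he n with h2 | h2 <;> rw [h2] at h1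
  · exact h4 (by rwa [pow_one] at h1)
  · exact h5 h1

/-- Turning always to the same side, one walks around a hexagon of the tiling. -/
theorem IsHolomorphic.exists_periodic_ray (hT : G.IsTree) (h3 : G.IsRegularOfDegree 3)
    {φ : V → ℂ} (hφ : IsHolomorphic G φ) (hne : ∃ x y, φ x ≠ φ y) {x y : V} (hxy : G.Adj x y) :
    ∃ S : Ray G, ∀ n, φ (S.1 (n + 6)) = φ (S.1 n) := by
  obtain ⟨S, -, -, hS, h⟩ := hφ.exists_walk_turning h3 hxy (fun _ => 1)
  have hb := hφ.nonbacktracking_of_turning hT.1 h3 hne (fun _ => Or.inl rfl) hS h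
  refine ⟨⟨S, hS, injective_of_nonbacktracking hT hS hb⟩, fun n => ?_⟩
  have h2 : ∀ k, φ (S (n + k + 1)) - φ (S (n + k)) = (-jRoot) ^ k * (φ (S (n + 1)) - φ (S n)) := by
    intro k
    induction k with
    | zero => simp
    | succ k ih =>
      have h4 := h (n + k)
      rw [pow_one] at h4
      rw [pow_succ]
      change φ (S (n + k + 2)) - φ (S (n + k + 1)) = _
      linear_combination h4 - jRoot * ih
  linear_combination h2 0 + h2 1 + h2 2 + h2 3 + h2 4 + h2 5 +
    (φ (S (n + 1)) - φ (S n)) * (1 - jRoot + jRoot ^ 2) * (-jRoot_cube)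

/-- Turning alternately to the two sides, one walks to infinity along a zigzag. -/
theorem IsHolomorphic.exists_zigzag (hT : G.IsTree) (h3 : G.IsRegularOfDegree 3)
    {φ : V → ℂ} (hφ : IsHolomorphic G φ) (hne : ∃ x y, φ x ≠ φ y) {x y : V} (hxy : G.Adj x y) :
    ∃ S : ℕ → V, S 0 = x ∧ S 1 = y ∧ (∀ n, G.Adj (S n) (S (n + 1))) ∧ (∀ n, S (n + 2) ≠ S n) ∧
      Tendsto (fun n => φ (S n)) atTop (cocompact ℂ) := by
  have hmod : ∀ n, n % 2 + 1 = 1 ∨ n % 2 + 1 = 2 := fun n => by omega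
  obtain ⟨S, hS0, hS1, hS, h⟩ := hφ.exists_walk_turning h3 hxy (fun n => n % 2 + 1)
  refine ⟨S, hS0, hS1, hS, hφ.nonbacktracking_of_turning hT.1 h3 hne hmod hS h, ?_⟩
  set d := φ y - φ x with hd
  have hd0 : d ≠ 0 := sub_ne_zero.2 (hφ.ne_of_adj hT.1 h3 hne hxy).symm
  have hval : ∀ k : ℕ, φ (S (2 * k)) = φ x + k * ((1 - jRoot) * d) ∧
      φ (S (2 * k + 1)) = φ x + k * ((1 - jRoot) * d) + d := by
    intro k
    induction k with
    | zero => simp [hS0, hS1, hd]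
    | succ k ih =>
      obtain ⟨ih0, ih1⟩ := ih
      have h4 := h (2 * k)
      have h5 := h (2 * k + 1)
      rw [Nat.mul_mod_right, zero_add, pow_one] at h4
      rw [show (2 * k + 1) % 2 + 1 = 2 by omega] at h5
      have h6 : φ (S (2 * (k + 1))) = φ x + (k + 1 : ℕ) * ((1 - jRoot) * d) := by
        rw [mul_add_one]
        push_cast
        linear_combination h4 + (1 - jRoot) * ih1 + jRoot * ih0
      refine ⟨h6, ?_⟩
      rw [mul_add_one] at h6 ⊢
      push_cast at h6 ⊢
      change φ (S (2 * k + 1 + 2)) = _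
      change φ (S (2 * k + 1 + 1)) = _ at h6
      linear_combination h5 + (1 - jRoot ^ 2) * h6 + jRoot ^ 2 * ih1 + d * jRoot_cube
  have hbound : ∀ n : ℕ, ((n / 2 : ℕ) : ℝ) * ‖(1 - jRoot) * d‖ - (‖φ x‖ + ‖d‖) ≤ ‖φ (S n)‖ := by
    have hk : ∀ (k : ℕ) (c : ℂ), ‖c‖ ≤ ‖φ x‖ + ‖d‖ →
        (k : ℝ) * ‖(1 - jRoot) * d‖ - (‖φ x‖ + ‖d‖) ≤ ‖c + k * ((1 - jRoot) * d)‖ := by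
      intro k c hc
      have h1 := norm_sub_le (c + k * ((1 - jRoot) * d)) c
      rw [add_sub_cancel_left, norm_mul, Complex.norm_natCast] at h1
      linarith
    intro n
    rcases Nat.even_or_odd' n with ⟨k, rfl | rfl⟩
    · rw [(hval k).1, Nat.mul_div_cancel_left _ (by norm_num)]
      exact hk k _ (le_add_of_nonneg_right (norm_nonneg _))
    · rw [(hval k).2, show (2 * k + 1) / 2 = k by omega, add_right_comm]
      exact hk k _ (norm_add_le _ _)
  rw [← Metric.cobounded_eq_cocompact, ← tendsto_norm_atTop_iff_cobounded]
  refine tendsto_atTop_mono hbound (tendsto_atTop_add_const_right _ _ ?_)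
  have hc : 0 < ‖(1 - jRoot) * d‖ :=
    norm_pos_iff.2 (mul_ne_zero (sub_ne_zero.2 jRoot_ne_one.symm) hd0)
  exact (tendsto_natCast_atTop_atTop.comp (Nat.tendsto_div_const_atTop (by norm_num))).atTop_mul_const
    hc

/-- Being unbounded is generic: every initial part of a ray can be continued by a zigzag. -/
theorem IsHolomorphic.residual_unbounded [TopologicalSpace V] [DiscreteTopology V] (hT : G.IsTree)
    (h3 : G.IsRegularOfDegree 3) {φ : V → ℂ} (hφ : IsHolomorphic G φ) (hne : ∃ x y, φ x ≠ φ y) :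
    {S : Ray G | ¬ Bornology.IsBounded (range fun n => φ (S.1 n))} ∈ residual (Ray G) := by
  have hU : ∀ M : ℕ, {S : Ray G | ∃ n, (M : ℝ) < ‖φ (S.1 n)‖} ∈ residual (Ray G) := by
    intro M
    refine residual_of_dense_open ?_ ?_
    · have : {S : Ray G | ∃ n, (M : ℝ) < ‖φ (S.1 n)‖}
          = ⋃ n, {S : Ray G | (M : ℝ) < ‖φ (S.1 n)‖} := by
        ext S
        simp
      rw [this]
      refine isOpen_iUnion fun n => isOpen_lt continuous_const ?_
      exact (continuous_of_discreteTopology (f := fun v => ‖φ v‖)).comp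
        ((continuous_apply n).comp continuous_subtype_val)
    · intro S
      have hext : ∀ N, ∃ S' : Ray G, (∀ n ≤ N, S'.1 n = S.1 n) ∧ ∃ n, (M : ℝ) < ‖φ (S'.1 n)‖ := by
        intro N
        obtain ⟨Z, hZ0, hZ1, hZ, hZb, hZt⟩ := hφ.exists_zigzag hT h3 hne (S.2.1 N)
        let R : ℕ → V := fun n => if n ≤ N then S.1 n else Z (n - N)
        have hRS : ∀ n ≤ N + 1, R n = S.1 n := by
          intro n hn
          by_cases h : n ≤ N
          · exact if_pos h
          · obtain rfl : n = N + 1 := by omega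
            simp only [R, if_neg h, Nat.add_sub_cancel_left, hZ1]
        have hRZ : ∀ n, R (N + n) = Z n := by
          intro n
          rcases Nat.eq_zero_or_pos n with rfl | h
          · rw [add_zero, hRS N (by omega), hZ0]
          · simp only [R, if_neg (show ¬ N + n ≤ N by omega), Nat.add_sub_cancel_left]
        have hR : ∀ n, G.Adj (R n) (R (n + 1)) := by
          intro n
          by_cases h : n ≤ N
          · rw [hRS n (by omega), hRS (n + 1) (by omega)]
            exact S.2.1 n
          · obtain ⟨m, rfl⟩ := Nat.exists_eq_add_of_le (le_of_not_ge h)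
            rw [add_assoc, hRZ, hRZ]
            exact hZ m
        have hRb : ∀ n, R (n + 2) ≠ R n := by
          intro n
          by_cases h : n + 1 ≤ N
          · rw [hRS n (by omega), hRS (n + 2) (by omega)]
            exact fun h => by simpa using S.2.2 h
          · obtain ⟨m, rfl⟩ := Nat.exists_eq_add_of_le (show N ≤ n by omega)
            rw [add_assoc, hRZ, hRZ]
            exact hZb m
        refine ⟨⟨R, hR, injective_of_nonbacktracking hT hR hRb⟩, fun n hn => hRS n (by omega), ?_⟩
        rw [← Metric.cobounded_eq_cocompact, ← tendsto_norm_atTop_iff_cobounded] at hZt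
        obtain ⟨n, hn⟩ := (hZt.eventually_gt_atTop (M : ℝ)).exists
        exact ⟨N + n, by change _ < ‖φ (R (N + n))‖; rwa [hRZ]⟩
      choose T hT1 hT2 using hext
      refine mem_closure_of_tendsto (f := T) (b := atTop) ?_ (Eventually.of_forall hT2)
      rw [tendsto_subtype_rng, tendsto_pi_nhds]
      intro n
      refine tendsto_const_nhds.congr' ?_
      filter_upwards [eventually_ge_atTop n] with N hN
      exact (hT1 N n hN).symm
  filter_upwards [(countable_iInter_mem).2 hU] with S hS hb
  obtain ⟨C, hC⟩ := hb.exists_norm_le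
  obtain ⟨M, hM⟩ := exists_nat_gt C
  obtain ⟨n, hn⟩ := mem_iInter.1 hS M
  exact absurd (hC _ (mem_range_self n)) (not_le.2 (hM.trans hn))

end Hol

/-! ### Similarities -/

theorem SG.exists_apply_eq {θ : ℂ} (hθ : θ ≠ 0) (t : ℂ) : ∃ s : SG, ∀ z, s z = θ * z + t := by
  refine ⟨(LinearEquiv.smulOfNeZero ℂ ℂ θ hθ).toAffineEquiv.trans (AffineEquiv.constVAdd ℂ ℂ t),
    fun z => ?_⟩
  change t + θ * z = θ * z + t
  ring

theorem SG.dist_apply (s : SG) (z z' : ℂ) : dist (s z) (s z') = ‖s.linear 1‖ * dist z z' := by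
  rw [SG.apply_eq s z, SG.apply_eq s z', dist_eq_norm, dist_eq_norm, ← norm_mul]
  congr 1
  ring

/-- A similarity is determined by the images of two points. -/
theorem SG.ext_of_ne {s s' : SG} {p q : ℂ} (hpq : p ≠ q) (hp : s p = s' p) (hq : s q = s' q) :
    s = s' := by
  rw [SG.apply_eq s, SG.apply_eq s'] at hp hq
  have h1 : s.linear 1 = s'.linear 1 :=
    mul_right_cancel₀ (sub_ne_zero.2 hpq) (by linear_combination hp - hq)
  have h2 : s 0 = s' 0 := by linear_combination hp - p * h1
  ext z
  rw [SG.apply_eq s, SG.apply_eq s', h1, h2]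

theorem SG.exists_map_eq {p q p' q' : ℂ} (hpq : p ≠ q) (hpq' : p' ≠ q') :
    ∃ s : SG, s p = p' ∧ s q = q' := by
  have h1 : q - p ≠ 0 := sub_ne_zero.2 hpq.symm
  obtain ⟨s, hs⟩ := SG.exists_apply_eq (div_ne_zero (sub_ne_zero.2 hpq'.symm) h1)
    (p' - (q' - p') / (q - p) * p)
  refine ⟨s, by rw [hs]; ring, ?_⟩
  rw [hs]
  field_simp
  ring

theorem SG.continuous_apply (z : ℂ) : Continuous fun s : SG => s z := by
  have h : Continuous fun s : SG => ((s.linear 1, s 0) : ℂ × ℂ) := continuous_induced_dom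
  have h2 : (fun s : SG => s z) = fun s : SG => s.linear 1 * z + s 0 :=
    funext fun s => SG.apply_eq s z
  rw [h2]
  exact (h.fst.mul continuous_const).add h.snd

/-- A family of similarities is continuous if its values at two points are. -/
theorem SG.continuous_of_apply {X : Type*} [TopologicalSpace X] {s : X → SG} {p q : ℂ}
    (hpq : p ≠ q) (hp : Continuous fun x => s x p) (hq : Continuous fun x => s x q) :
    Continuous s := by
  have h1 : q - p ≠ 0 := sub_ne_zero.2 hpq.symm
  have hlin : (fun x => (s x).linear 1) = fun x => (s x q - s x p) / (q - p) := by
    funext x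
    rw [SG.apply_eq (s x) p, SG.apply_eq (s x) q, eq_div_iff h1]
    ring
  have hlc : Continuous fun x => (s x).linear 1 := by
    rw [hlin]
    exact (hq.sub hp).div_const _
  refine continuous_induced_rng.2 (hlc.prodMk ?_)
  have hzero : (fun x => s x 0) = fun x => s x p - (s x).linear 1 * p := by
    funext x
    rw [SG.apply_eq (s x) p]
    ring
  change Continuous fun x => s x 0
  rw [hzero]
  exact hp.sub (hlc.mul continuous_const)

theorem norm_sub_le_dist_of_mem_hexVertices {α β p q : ℂ} (hαβ : α ≠ β)
    (hp : p ∈ hexVertices α β) (hq : q ∈ hexVertices α β) (hpq : p ≠ q) :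
    ‖β - α‖ ≤ dist p q := by
  obtain ⟨z, rfl, hz⟩ := (mem_hexVertices_iff hαβ).1 hp
  obtain ⟨z', rfl, hz'⟩ := (mem_hexVertices_iff hαβ).1 hq
  have hd : dist (α + (β - α) * z) (α + (β - α) * z') = ‖β - α‖ * ‖z - z'‖ := by
    rw [dist_eq_norm, ← norm_mul]
    congr 1
    ring
  rw [hd]
  refine le_mul_of_one_le_right (norm_nonneg _) ?_
  have hne : z - z' ≠ 0 := fun h => hpq (by rw [sub_eq_zero.1 h])
  obtain ⟨k, hk⟩ : ∃ k, EisClass k (z - z') := by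
    rcases hz with hz | hz <;> rcases hz' with hz' | hz' <;> exact ⟨_, hz.sub hz'⟩
  obtain ⟨n, hn, -⟩ := hk.exists_normSq
  have hn0 : (0 : ℝ) < n := hn ▸ Complex.normSq_pos.2 hne
  have hn1 : (1 : ℝ) ≤ n := by exact_mod_cast Int.add_one_le_of_lt (Int.cast_pos.1 hn0)
  rw [Complex.normSq_eq_norm_sq] at hn
  nlinarith [norm_nonneg (z - z')]

/-- A similarity that preserves the vertices of a tiling is an isometry, since it preserves the
minimal distance between vertices. -/
theorem SG.norm_linear_eq_one {α β : ℂ} (hαβ : α ≠ β) {s : SG}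
    (hs : s '' hexVertices α β = hexVertices α β) : ‖s.linear 1‖ = 1 := by
  have hw : 0 < ‖β - α‖ := norm_pos_iff.2 (sub_ne_zero.2 hαβ.symm)
  have hα : α ∈ hexVertices α β := (mem_hexVertices_iff hαβ).2 ⟨0, by ring, Or.inl .zero⟩
  have hβ : β ∈ hexVertices α β := (mem_hexVertices_iff hαβ).2 ⟨1, by ring, Or.inr .one⟩
  have hd : dist α β = ‖β - α‖ := by rw [dist_comm, dist_eq_norm]
  apply le_antisymm
  · obtain ⟨p, hp, hpα⟩ := hs.symm ▸ hα
    obtain ⟨q, hq, hqβ⟩ := hs.symm ▸ hβ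
    have h1 := norm_sub_le_dist_of_mem_hexVertices hαβ hp hq
      (fun h => hαβ (by rw [← hpα, ← hqβ, h]))
    have h2 := SG.dist_apply s p q
    rw [hpα, hqβ, hd] at h2
    by_contra h
    nlinarith
  · have h1 := norm_sub_le_dist_of_mem_hexVertices hαβ (hs ▸ mem_image_of_mem s hα)
      (hs ▸ mem_image_of_mem s hβ) (s.injective.ne hαβ)
    rw [SG.dist_apply, hd] at h1
    by_contra h
    nlinarith

theorem SG.bijOn_hexStar {α β : ℂ} (hαβ : α ≠ β) {s : SG}
    (hs : s '' hexVertices α β = hexVertices α β) (p : ℂ) :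
    BijOn s (hexStar α β p) (hexStar α β (s p)) := by
  have hd : ∀ q, dist (s p) (s q) = dist p q := fun q => by
    rw [SG.dist_apply, SG.norm_linear_eq_one hαβ hs, one_mul]
  refine ⟨fun q hq => ⟨hs ▸ mem_image_of_mem s hq.1, (hd q).trans hq.2⟩, s.injective.injOn, ?_⟩
  rintro q ⟨hq, hq'⟩
  obtain ⟨r, hr, rfl⟩ := hs.symm ▸ hq
  exact ⟨r, ⟨hr, (hd r).symm.trans hq'⟩, rfl⟩

/-- The rotations of order three about a vertex preserve the tiling. -/
theorem exists_similarity_image_hexVertices {α β : ℂ} (hαβ : α ≠ β) :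
    ∃ s : SG, s ≠ 1 ∧ s '' hexVertices α β = hexVertices α β := by
  obtain ⟨s, hs⟩ := SG.exists_apply_eq IsHexUnit.j.ne_zero (α - jRoot * α)
  have hcls : ∀ n z, (EisClass 0 z ∨ EisClass 1 z) →
      (EisClass 0 (jRoot ^ n * z) ∨ EisClass 1 (jRoot ^ n * z)) := by
    intro n z hz
    have h1 : EisClass 1 (jRoot ^ n) := by
      have := EisClass.j.pow n
      rwa [one_pow] at this
    exact hz.imp (fun h => by simpa using h1.mul h) (fun h => by simpa using h1.mul h)
  refine ⟨s, ?_, Subset.antisymm ?_ ?_⟩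
  · rintro rfl
    have h1 := hs 1
    have h0 := hs 0
    change (1 : ℂ) = _ at h1
    change (0 : ℂ) = _ at h0
    exact jRoot_ne_one (by linear_combination h0 - h1)
  · rintro _ ⟨p, hp, rfl⟩
    obtain ⟨z, rfl, hz⟩ := (mem_hexVertices_iff hαβ).1 hp
    exact (mem_hexVertices_iff hαβ).2 ⟨jRoot ^ 1 * z, by rw [hs]; ring, hcls 1 z hz⟩
  · intro p hp
    obtain ⟨z, rfl, hz⟩ := (mem_hexVertices_iff hαβ).1 hp
    refine ⟨_, (mem_hexVertices_iff hαβ).2 ⟨jRoot ^ 2 * z, rfl, hcls 2 z hz⟩, ?_⟩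
    rw [hs]
    linear_combination (β - α) * z * jRoot_cube

/-! ### The actions of the automorphism groups -/

section Aut

variable {V : Type u} {G : SimpleGraph V}

theorem Aut.inv_apply_self (γ : Aut G) (x : V) : γ⁻¹ (γ x) = x := γ.symm_apply_apply x

theorem Aut.apply_inv_self (γ : Aut G) (x : V) : γ (γ⁻¹ x) = x := γ.apply_symm_apply x

variable [TopologicalSpace V]

theorem Aut.continuous_apply (x : V) : Continuous fun γ : Aut G => γ x :=
  (_root_.continuous_apply x).comp continuous_induced_dom

theorem Aut.eventually_apply_eq [DiscreteTopology V] (γ₀ : Aut G) (x : V) :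
    ∀ᶠ γ in 𝓝 γ₀, γ x = γ₀ x :=
  (Aut.continuous_apply x).continuousAt.eventually (isOpen_discrete {γ₀ x} |>.mem_nhds rfl)

theorem continuous_of_eventually_eq {X Y : Type*} [TopologicalSpace X] [TopologicalSpace Y]
    {f : X → Y} (h : ∀ t₀, ∀ᶠ t in 𝓝 t₀, f t = f t₀) : Continuous f :=
  continuous_iff_continuousAt.2 fun t₀ =>
    (continuousAt_const (y := f t₀)).congr ((h t₀).mono fun _ h => h.symm)

theorem Aut.continuous_inv_apply [DiscreteTopology V] (x : V) :
    Continuous fun γ : Aut G => γ⁻¹ x := by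
  refine continuous_of_eventually_eq fun γ₀ => ?_
  filter_upwards [Aut.eventually_apply_eq γ₀ (γ₀⁻¹ x)] with γ hγ
  rw [Aut.apply_inv_self] at hγ
  conv_lhs => rw [← hγ]
  exact Aut.inv_apply_self γ _

theorem Aut.continuous_of_eventually_eq {X : Type*} [TopologicalSpace X] {γ : X → Aut G}
    (h : ∀ x t₀, ∀ᶠ t in 𝓝 t₀, γ t x = γ t₀ x) : Continuous γ :=
  continuous_induced_rng.2
    (continuous_pi fun x => HolTree.continuous_of_eventually_eq (h x))

end Aut

section Actions

variable {V : Type u} {G : SimpleGraph V} [G.LocallyFinite]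

theorem mem_stabilizer_aut_iff (φ : HolStar G) (γ : Aut G) :
    γ ∈ MulAction.stabilizer (Aut G) φ ↔ ∀ x, φ.1 (γ x) = φ.1 x := by
  rw [MulAction.mem_stabilizer_iff]
  constructor
  · intro h x
    have : φ.1 (γ⁻¹ (γ x)) = φ.1 (γ x) := congrFun (congrArg Subtype.val h) (γ x)
    rw [← this, Aut.inv_apply_self]
  · intro h
    refine Subtype.ext (funext fun x => ?_)
    change φ.1 (γ⁻¹ x) = φ.1 x
    rw [← h, Aut.apply_inv_self]

theorem mem_stabilizer_prod_iff (φ : HolStar G) (g : SG × Aut G) :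
    g ∈ MulAction.stabilizer (SG × Aut G) φ ↔ ∀ x, φ.1 (g.2 x) = g.1 (φ.1 x) := by
  rw [MulAction.mem_stabilizer_iff]
  constructor
  · intro h x
    have : g.1 (φ.1 (g.2⁻¹ (g.2 x))) = φ.1 (g.2 x) := congrFun (congrArg Subtype.val h) (g.2 x)
    rw [← this, Aut.inv_apply_self]
  · intro h
    refine Subtype.ext (funext fun x => ?_)
    change g.1 (φ.1 (g.2⁻¹ x)) = φ.1 x
    rw [← h, Aut.apply_inv_self]

/-- Holomorphic functions with the same values on the edge `a b` differ by exactly one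
automorphism that fixes the edge: both are coverings of the same tiling. -/
theorem existsUnique_fixEdge (hT : G.IsTree) (h3 : G.IsRegularOfDegree 3) {a b : V}
    (hab : G.Adj a b) {φ ψ : V → ℂ} (hφ : IsHolomorphic G φ) (hψ : IsHolomorphic G ψ)
    (hne : φ a ≠ φ b) (ha : φ a = ψ a) (hb : φ b = ψ b) :
    ∃! γ : fixEdge G a b, ∀ x, φ ((γ.1)⁻¹ x) = ψ x := by
  have hφc := hφ.isStarCover hT.1 h3 hab hne
  have hψc := hψ.isStarCover hT.1 h3 hab (ha ▸ hb ▸ hne)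
  rw [← ha, ← hb] at hψc
  obtain ⟨γ, hγa, hγ⟩ := hφc.exists_aut hψc hT ha
  have hγb : γ b = b := by
    refine (hψc a).injOn ?_ hab ((hγ b).trans hb)
    have : G.Adj (γ a) (γ b) := γ.map_rel_iff.2 hab
    rwa [hγa] at this
  refine ⟨⟨γ, hγa, hγb⟩, fun x => ?_, fun δ hδ => Subtype.ext ?_⟩
  · rw [← hγ, Aut.apply_inv_self]
  · refine hψc.aut_ext hT.1 (a := a) (fun x => ?_) (δ.2.1.trans hγa.symm)
    rw [← hδ, Aut.inv_apply_self, hγ]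

theorem isSimplyTransitive_holValues (hT : G.IsTree) (h3 : G.IsRegularOfDegree 3) {a b : V}
    (hab : G.Adj a b) {α β : ℂ} (hαβ : α ≠ β) :
    IsSimplyTransitive (fixEdge G a b) (HolValues G a b α β) := by
  obtain ⟨φ₀, h1, h2, h4⟩ := exists_isHolomorphic hT h3 hab α β
  refine ⟨⟨φ₀, h1, h2, h4⟩, fun φ ψ => ?_⟩
  obtain ⟨γ, hγ, hu⟩ := existsUnique_fixEdge hT h3 hab φ.2.1 ψ.2.1
    (by rw [φ.2.2.1, φ.2.2.2]; exact hαβ) (φ.2.2.1.trans ψ.2.2.1.symm)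
    (φ.2.2.2.trans ψ.2.2.2.symm)
  exact ⟨γ, Subtype.ext (funext hγ), fun δ hδ => hu δ (congrFun (congrArg Subtype.val hδ))⟩

theorem isSimplyTransitive_holStar (hT : G.IsTree) (h3 : G.IsRegularOfDegree 3) {a b : V}
    (hab : G.Adj a b) : IsSimplyTransitive (SG × fixEdge G a b) (HolStar G) := by
  obtain ⟨φ₀, h1, h2, h4⟩ := exists_isHolomorphic hT h3 hab 0 1
  refine ⟨⟨φ₀, h1, a, b, by rw [h2, h4]; exact zero_ne_one⟩, fun φ ψ => ?_⟩
  have hne := φ.2.1.ne_of_adj hT.1 h3 φ.2.2 hab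
  obtain ⟨s, hsa, hsb⟩ := SG.exists_map_eq hne (ψ.2.1.ne_of_adj hT.1 h3 ψ.2.2 hab)
  obtain ⟨γ, hγ, hu⟩ := existsUnique_fixEdge hT h3 hab (φ.2.1.comp_similarity s) ψ.2.1
    (s.injective.ne hne) hsa hsb
  refine ⟨(s, γ), Subtype.ext (funext hγ), ?_⟩
  rintro ⟨s', δ⟩ h
  have h' : ∀ x, s' (φ.1 ((δ.1)⁻¹ x)) = ψ.1 x := congrFun (congrArg Subtype.val h)
  have ha : (δ.1)⁻¹ a = a := (δ⁻¹).2.1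
  have hb : (δ.1)⁻¹ b = b := (δ⁻¹).2.2
  have h1 := h' a
  have h2 := h' b
  rw [ha, ← hsa] at h1
  rw [hb, ← hsb] at h2
  obtain rfl := SG.ext_of_ne hne h1 h2
  exact Prod.ext rfl (hu δ h')

/-! ### Stabilizers -/

/-- If `s` permutes the vertices of the tiling, `s ∘ φ` and `φ` cover the same tiling and differ by an
automorphism of the tree. -/
theorem exists_mem_stabilizer_iff (hT : G.IsTree) (h3 : G.IsRegularOfDegree 3) {a b : V}
    (hab : G.Adj a b) (φ : HolStar G) (s : SG) :
    (∃ γ : Aut G, (s, γ) ∈ MulAction.stabilizer (SG × Aut G) φ) ↔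
      s '' range φ.1 = range φ.1 := by
  constructor
  · rintro ⟨γ, hγ⟩
    rw [mem_stabilizer_prod_iff] at hγ
    rw [← range_comp]
    refine Subset.antisymm ?_ ?_
    · rintro _ ⟨x, rfl⟩
      exact ⟨γ x, hγ x⟩
    · rintro _ ⟨x, rfl⟩
      refine ⟨γ⁻¹ x, (hγ _).symm.trans ?_⟩
      rw [Aut.apply_inv_self]
  · intro hs
    have hne := φ.2.1.ne_of_adj hT.1 h3 φ.2.2 hab
    have hc := φ.2.1.isStarCover hT.1 h3 hab hne
    obtain ⟨a', ha'⟩ : s (φ.1 a) ∈ range φ.1 := hs ▸ mem_image_of_mem s (mem_range_self a)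
    rw [φ.2.1.range_eq hT.1 h3 hab hne] at hs
    have hsc : IsStarCover G (hexStar (φ.1 a) (φ.1 b)) (fun x => s (φ.1 x)) := fun x =>
      (SG.bijOn_hexStar hne hs (φ.1 x)).comp (hc x)
    obtain ⟨γ, -, hγ⟩ := hsc.exists_aut hc hT ha'.symm
    exact ⟨γ, (mem_stabilizer_prod_iff φ (s, γ)).2 hγ⟩

theorem stabilizer_ne_bot (hT : G.IsTree) (h3 : G.IsRegularOfDegree 3) {a b : V}
    (hab : G.Adj a b) (φ : HolStar G) : MulAction.stabilizer (SG × Aut G) φ ≠ ⊥ := by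
  have hne := φ.2.1.ne_of_adj hT.1 h3 φ.2.2 hab
  obtain ⟨s, hs1, hs⟩ := exists_similarity_image_hexVertices hne
  rw [← φ.2.1.range_eq hT.1 h3 hab hne] at hs
  obtain ⟨γ, hγ⟩ := (exists_mem_stabilizer_iff hT h3 hab φ s).2 hs
  intro h
  rw [h, Subgroup.mem_bot] at hγ
  exact hs1 (congrArg Prod.fst hγ)

/-! ### Topology of the actions -/

theorem isClosed_isHarmonic : IsClosed {f : V → ℂ | IsHarmonic G f} := by
  have : {f : V → ℂ | IsHarmonic G f} = ⋂ x, {f | laplacian G f x = 0} := by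
    ext f
    simp [IsHarmonic]
  rw [this]
  refine isClosed_iInter fun x => isClosed_eq ?_ continuous_const
  exact continuous_const.mul (continuous_finsetSum _ fun y _ =>
    (continuous_apply y).sub (continuous_apply x))

/-- The holomorphic functions with given values on an edge form a closed subset of a product of
discs. -/
theorem compactSpace_holValues (hG : G.Connected) (h3 : G.IsRegularOfDegree 3) {a b : V}
    (hab : G.Adj a b) {α β : ℂ} (hαβ : α ≠ β) : CompactSpace (HolValues G a b α β) := by
  have hbound : ∀ x, ∃ r : ℝ, ∀ φ : V → ℂ, IsHolomorphic G φ → φ a = α → φ b = β →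
      φ x ∈ Metric.closedBall α r := by
    refine connected_induction hG a ⟨0, fun φ _ ha _ => by simp [ha]⟩ ?_
    rintro x y hxy ⟨r, hr⟩
    refine ⟨r + ‖β - α‖, fun φ hφ ha hb => ?_⟩
    have h1 := hr φ hφ ha hb
    have h2 := ((hφ.isStarCover hG h3 hab (by rw [ha, hb]; exact hαβ) x).mapsTo hxy).2
    rw [ha, hb] at h2
    rw [Metric.mem_closedBall] at h1 ⊢
    have h4 := dist_triangle (φ y) (φ x) α
    rw [dist_comm (φ y) (φ x)] at h4
    linarith
  choose r hr using hbound
  refine isCompact_iff_compactSpace.1 (IsCompact.of_isClosed_subset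
    (isCompact_univ_pi fun x => isCompact_closedBall α (r x)) ?_
    (fun φ hφ x _ => hr x φ hφ.1 hφ.2.1 hφ.2.2))
  have hsq : Continuous fun (f : V → ℂ) (x : V) => f x ^ 2 :=
    continuous_pi fun x => (continuous_apply x).pow 2
  exact (isClosed_isHarmonic.inter (isClosed_isHarmonic.preimage hsq)).inter
    ((isClosed_eq (continuous_apply a) continuous_const).inter
      (isClosed_eq (continuous_apply b) continuous_const))

variable [TopologicalSpace V] [DiscreteTopology V]

/-- The orbit maps of a simply transitive action are homeomorphisms if they are continuous and the
unique group element that carries `φ` to `ψ` depends continuously on `ψ`. -/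
theorem IsSimplyTransitive.isHomeomorph_orbit {K X : Type*} [Group K] [MulAction K X]
    [TopologicalSpace K] [TopologicalSpace X] (h : IsSimplyTransitive K X) (φ : X)
    (hc : Continuous fun k : K => k • φ)
    (hi : ∀ k : X → K, (∀ ψ, k ψ • φ = ψ) → Continuous k) :
    IsHomeomorph fun k : K => k • φ := by
  choose k hk hu using fun ψ => h.2 φ ψ
  exact isHomeomorph_iff_exists_inverse.2
    ⟨hc, k, fun g => (hu (g • φ) g rfl).symm, hk, hi k hk⟩

theorem isHomeomorph_holValues (hT : G.IsTree) (h3 : G.IsRegularOfDegree 3) {a b : V}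
    (hab : G.Adj a b) {α β : ℂ} (hαβ : α ≠ β) (φ : HolValues G a b α β) :
    IsHomeomorph (fun γ : fixEdge G a b => γ • φ) := by
  refine (isSimplyTransitive_holValues hT h3 hab hαβ).isHomeomorph_orbit φ ?_ ?_
  · refine continuous_induced_rng.2 (continuous_pi fun x => ?_)
    exact (continuous_of_discreteTopology (f := φ.1)).comp
      ((Aut.continuous_inv_apply x).comp continuous_subtype_val)
  · intro γ hγ
    refine continuous_induced_rng.2 (Aut.continuous_of_eventually_eq fun x ψ₀ => ?_)
    refine eventually_lift_eq (G' := G) hT.1 (φ := fun _ => φ.1)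
      (ψ := fun ψ : HolValues G a b α β => ψ.1) (γ := fun ψ x => (γ ψ).1 x)
      (fun _ => continuous_const) (fun x => (continuous_apply x).comp continuous_subtype_val)
      (fun ψ => ψ.2.1.injOn_neighborSet hT.1 h3 ⟨a, b, by rw [ψ.2.2.1, ψ.2.2.2]; exact hαβ⟩)
      (fun ψ x y h => (γ ψ).1.map_rel_iff.2 h) (fun ψ x => ?_) ψ₀ (a := a)
      (Eventually.of_forall fun ψ => (γ ψ).2.1.trans (γ ψ₀).2.1.symm) x
    have h1 : φ.1 (((γ ψ).1)⁻¹ ((γ ψ).1 x)) = ψ.1 ((γ ψ).1 x) :=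
      congrFun (congrArg Subtype.val (hγ ψ)) _
    rw [← h1, Aut.inv_apply_self]

theorem isHomeomorph_holStar (hT : G.IsTree) (h3 : G.IsRegularOfDegree 3) {a b : V}
    (hab : G.Adj a b) (φ : HolStar G) :
    IsHomeomorph (fun g : SG × fixEdge G a b => g • φ) := by
  refine (isSimplyTransitive_holStar hT h3 hab).isHomeomorph_orbit φ ?_ ?_
  · refine continuous_induced_rng.2 (continuous_pi fun x => ?_)
    have h1 : Continuous fun g : SG × fixEdge G a b => φ.1 ((g.2.1)⁻¹ x) :=
      (continuous_of_discreteTopology (f := φ.1)).comp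
        ((Aut.continuous_inv_apply x).comp (continuous_subtype_val.comp continuous_snd))
    have h2 : Continuous fun s : SG => ((s.linear 1, s 0) : ℂ × ℂ) := continuous_induced_dom
    have h4 := h2.comp (continuous_fst (X := SG) (Y := fixEdge G a b))
    refine ((h4.fst.mul h1).add h4.snd).congr fun g => ?_
    exact (SG.apply_eq g.1 _).symm
  · intro g hg
    have hval : ∀ ψ x, (g ψ).1 (φ.1 x) = ψ.1 ((g ψ).2.1 x) := by
      intro ψ x
      have h1 : (g ψ).1 (φ.1 (((g ψ).2.1)⁻¹ ((g ψ).2.1 x))) = ψ.1 ((g ψ).2.1 x) :=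
        congrFun (congrArg Subtype.val (hg ψ)) _
      rw [← h1, Aut.inv_apply_self]
    have heval : ∀ x, Continuous fun ψ : HolStar G => ψ.1 x := fun x =>
      (continuous_apply x).comp continuous_subtype_val
    have hs : Continuous fun ψ => (g ψ).1 := by
      refine SG.continuous_of_apply (φ.2.1.ne_of_adj hT.1 h3 φ.2.2 hab)
        ((heval a).congr fun ψ => ?_) ((heval b).congr fun ψ => ?_)
      · rw [hval, (g ψ).2.2.1]
      · rw [hval, (g ψ).2.2.2]
    refine hs.prodMk (continuous_induced_rng.2 (Aut.continuous_of_eventually_eq fun x ψ₀ => ?_))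
    exact eventually_lift_eq (G' := G) hT.1 (φ := fun ψ x => (g ψ).1 (φ.1 x))
      (ψ := fun ψ : HolStar G => ψ.1) (γ := fun ψ x => (g ψ).2.1 x)
      (fun x => (SG.continuous_apply _).comp hs) heval
      (fun ψ => ψ.2.1.injOn_neighborSet hT.1 h3 ψ.2.2)
      (fun ψ x y h => (g ψ).2.1.map_rel_iff.2 h) (fun ψ x => (hval ψ x).symm) ψ₀ (a := a)
      (Eventually.of_forall fun ψ => (g ψ).2.2.1.trans (g ψ₀).2.2.1.symm) x

/-- The group is homeomorphic to the compact space on which it acts simply transitively. -/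
theorem compactSpace_fixEdge (hT : G.IsTree) (h3 : G.IsRegularOfDegree 3) {a b : V}
    (hab : G.Adj a b) : CompactSpace (fixEdge G a b) := by
  obtain ⟨φ⟩ := (isSimplyTransitive_holValues hT h3 hab (zero_ne_one (α := ℂ))).1
  have := compactSpace_holValues hT.1 h3 hab (zero_ne_one (α := ℂ))
  exact ((isHomeomorph_holValues hT h3 hab zero_ne_one φ).homeomorph _).symm.compactSpace

/-- An element of the stabilizer is determined by its action on the two ends of an edge, which
takes place in a discrete space. -/
theorem discreteTopology_stabilizer_prod (hT : G.IsTree) (h3 : G.IsRegularOfDegree 3) {a b : V}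
    (hab : G.Adj a b) (φ : HolStar G) :
    DiscreteTopology (MulAction.stabilizer (SG × Aut G) φ) := by
  have hne := φ.2.1.ne_of_adj hT.1 h3 φ.2.2 hab
  have hc := φ.2.1.isStarCover hT.1 h3 hab hne
  refine discreteTopology_iff_isOpen_singleton.2 fun g => ?_
  have hcont : ∀ x, Continuous fun k : MulAction.stabilizer (SG × Aut G) φ => k.1.2 x :=
    fun x => (Aut.continuous_apply x).comp (continuous_snd.comp continuous_subtype_val)
  have hset : {g} = {k : MulAction.stabilizer (SG × Aut G) φ | k.1.2 a = g.1.2 a}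
      ∩ {k | k.1.2 b = g.1.2 b} := by
    refine Subset.antisymm (by rintro _ rfl; exact ⟨rfl, rfl⟩) ?_
    rintro k ⟨hka, hkb⟩
    have hk := (mem_stabilizer_prod_iff φ k.1).1 k.2
    have hg := (mem_stabilizer_prod_iff φ g.1).1 g.2
    have hs : k.1.1 = g.1.1 := SG.ext_of_ne hne
      (by rw [← hk, ← hg]; exact congrArg φ.1 hka) (by rw [← hk, ← hg]; exact congrArg φ.1 hkb)
    exact Subtype.ext (Prod.ext hs (hc.aut_ext hT.1 (fun x => by rw [hk, hg, hs]) hka))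
  rw [hset]
  exact ((isOpen_discrete {g.1.2 a}).preimage (hcont a)).inter
    ((isOpen_discrete {g.1.2 b}).preimage (hcont b))

theorem discreteTopology_stabilizer_aut (hT : G.IsTree) (h3 : G.IsRegularOfDegree 3) {a b : V}
    (hab : G.Adj a b) (φ : HolStar G) : DiscreteTopology (MulAction.stabilizer (Aut G) φ) := by
  have hc := φ.2.1.isStarCover hT.1 h3 hab (φ.2.1.ne_of_adj hT.1 h3 φ.2.2 hab)
  refine discreteTopology_iff_isOpen_singleton.2 fun g => ?_
  have hset : {g} = {k : MulAction.stabilizer (Aut G) φ | k.1 a = g.1 a} := by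
    refine Subset.antisymm (by rintro _ rfl; rfl) fun k hk => Subtype.ext ?_
    refine hc.aut_ext hT.1 (fun x => ?_) hk
    rw [(mem_stabilizer_aut_iff φ k.1).1 k.2, (mem_stabilizer_aut_iff φ g.1).1 g.2]
  rw [hset]
  exact (isOpen_discrete {g.1 a}).preimage ((Aut.continuous_apply a).comp continuous_subtype_val)

end Actions

end HolTree

end

theorem mainTheorem3 {V : Type*} [TopologicalSpace V] [DiscreteTopology V]
    (G : SimpleGraph V) [G.LocallyFinite] (hT : G.IsTree) (h3 : G.IsRegularOfDegree 3) :
    -- a non-constant holomorphic function is a universal covering of a hexagonal tiling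
    (∀ (φ : HolStar G) (a b : V), G.Adj a b →
      φ.1 a ≠ φ.1 b ∧
      range φ.1 = hexVertices (φ.1 a) (φ.1 b) ∧
      ∃ f : G →g hexGraph (φ.1 a) (φ.1 b),
        (∀ x, (f x : ℂ) = φ.1 x) ∧
        IsUniversalCovering f ∧
        (∀ (I : Set ℤ) (S : ℤ → V), I.OrdConnected → IsGeodesicOn G I S →
          IsLocallyInjectiveWalkOn (hexGraph (φ.1 a) (φ.1 b)) I (fun n => f (S n))) ∧
        -- the stabilizer in `Aut G` is the fundamental group of the tiling
        ∀ x, ∃ e : MulAction.stabilizer (Aut G) φ ≃* GraphPi1 (hexGraph (φ.1 a) (φ.1 b)) (f x),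
          ∀ (γ : MulAction.stabilizer (Aut G) φ) (p : G.Walk x (γ.1 x)) (h : f (γ.1 x) = f x),
            e γ = GraphPi1.mk ((p.map f).copy rfl h)) ∧
    -- up to a similarity the tiling is the standard one
    (∀ φ : HolStar G, ∃ (s : SG) (f : G →g hexGraph 0 1),
      (∀ x, (f x : ℂ) = s (φ.1 x)) ∧ IsUniversalCovering f) ∧
    (∀ φ : HolStar G, IsLocallyInjective G φ ∧ IsConformal G φ) ∧
    -- the image of a geodesic may be periodic or tend to infinity; generically it is unbounded
    (∀ φ : HolStar G,
      (∃ S : Ray G, ∃ m : ℕ, 0 < m ∧ ∀ n, φ.1 (S.1 (n + m)) = φ.1 (S.1 n)) ∧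
      (∃ S : Ray G, Tendsto (fun n => φ.1 (S.1 n)) atTop (cocompact ℂ)) ∧
      {S : Ray G | ¬ Bornology.IsBounded (range fun n => φ.1 (S.1 n))} ∈ residual (Ray G)) ∧
    -- the simply transitive actions
    (∀ a b : V, G.Adj a b →
      CompactSpace (fixEdge G a b) ∧
      (∀ α β : ℂ, α ≠ β →
        CompactSpace (HolValues G a b α β) ∧
        IsSimplyTransitive (fixEdge G a b) (HolValues G a b α β) ∧
        ∀ φ : HolValues G a b α β, IsHomeomorph (fun γ : fixEdge G a b => γ • φ)) ∧
      IsSimplyTransitive (SG × fixEdge G a b) (HolStar G) ∧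
      ∀ φ : HolStar G, IsHomeomorph (fun g : SG × fixEdge G a b => g • φ)) ∧
    -- the action of `SG × Aut G`
    MulAction.IsPretransitive (SG × Aut G) (HolStar G) ∧
    ∀ φ : HolStar G,
      MulAction.stabilizer (SG × Aut G) φ ≠ ⊥ ∧
      DiscreteTopology (MulAction.stabilizer (SG × Aut G) φ) ∧
      (∀ s : SG, (∃ γ : Aut G, (s, γ) ∈ MulAction.stabilizer (SG × Aut G) φ) ↔
        s '' range φ.1 = range φ.1) ∧
      DiscreteTopology (MulAction.stabilizer (Aut G) φ) ∧
      ∀ γ ∈ MulAction.stabilizer (Aut G) φ, γ ≠ 1 →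
        (∀ x, γ x ≠ x) ∧ ∀ x y, G.Adj x y → ¬ (γ x = y ∧ γ y = x) := by
  obtain ⟨a₀⟩ := hT.1.nonempty
  obtain ⟨b₀, h₀⟩ : ∃ b, G.Adj a₀ b := by
    refine (G.degree_pos_iff_exists_adj a₀).1 ?_
    rw [h3 a₀]
    norm_num
  refine ⟨fun φ a b hab => ?_, fun φ => ?_, fun φ => ⟨φ.2.1.isLocallyInjective hT.1 h3 φ.2.2,
    φ.2.1.isConformal hT.1 h3 φ.2.2⟩, fun φ => ⟨?_, ?_, φ.2.1.residual_unbounded hT h3 φ.2.2⟩,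
    fun a b hab => ⟨compactSpace_fixEdge hT h3 hab,
      fun α β hαβ => ⟨compactSpace_holValues hT.1 h3 hab hαβ,
        isSimplyTransitive_holValues hT h3 hab hαβ, isHomeomorph_holValues hT h3 hab hαβ⟩,
      isSimplyTransitive_holStar hT h3 hab, isHomeomorph_holStar hT h3 hab⟩, ⟨fun φ ψ => ?_⟩,
    fun φ => ⟨stabilizer_ne_bot hT h3 h₀ φ, discreteTopology_stabilizer_prod hT h3 h₀ φ,
      exists_mem_stabilizer_iff hT h3 h₀ φ, discreteTopology_stabilizer_aut hT h3 h₀ φ,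
      fun γ hγ hγ1 => ⟨fun x hx => hγ1 ?_, ?_⟩⟩⟩
  · have hne := φ.2.1.ne_of_adj hT.1 h3 φ.2.2 hab
    obtain ⟨f, hfφ, hf⟩ := φ.2.1.exists_hom hT h3 hab hne
    refine ⟨hne, φ.2.1.range_eq hT.1 h3 hab hne, f, hfφ, hf, fun I S hI hS => ?_, fun x => ?_⟩
    · refine ⟨fun n h h' => f.map_rel (hS.1 n h h'), fun n h h' => (f.map_rel (hS.1 n h h')).ne,
        fun n h h' heq => ?_⟩
      have hmem : n + 1 ∈ I := hI.out h h' ⟨by omega, by omega⟩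
      have h1 : G.Adj (S (n + 1)) (S (n + 2)) := by
        have := hS.1 (n + 1) hmem
        rw [add_assoc] at this
        exact this h'
      have h2 := hS.2 h h' ((hf.2.2 (S (n + 1))).injOn (hS.1 n h hmem).symm h1 heq)
      omega
    · refine exists_mulEquiv_graphPi1 hT hf.2.2 _ (fun γ => ?_) x
      rw [mem_stabilizer_aut_iff]
      exact forall_congr' fun y => by rw [Subtype.ext_iff, hfφ (γ y), hfφ y]
  · have hne := φ.2.1.ne_of_adj hT.1 h3 φ.2.2 h₀
    obtain ⟨s, hs0, hs1⟩ := SG.exists_map_eq hne (zero_ne_one (α := ℂ))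
    obtain ⟨f, hf⟩ := (φ.2.1.comp_similarity s).exists_hom hT h3 h₀ (s.injective.ne hne)
    refine ⟨s, ?_⟩
    rw [← hs0, ← hs1]
    exact ⟨f, hf⟩
  · obtain ⟨S, hS⟩ := φ.2.1.exists_periodic_ray hT h3 φ.2.2 h₀
    exact ⟨S, 6, by norm_num, hS⟩
  · obtain ⟨S, -, -, hS, hb, ht⟩ := φ.2.1.exists_zigzag hT h3 φ.2.2 h₀
    exact ⟨⟨S, hS, injective_of_nonbacktracking hT hS hb⟩, ht⟩
  · obtain ⟨g, hg, -⟩ := (isSimplyTransitive_holStar hT h3 h₀).2 φ ψ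
    exact ⟨(g.1, g.2.1), hg⟩
  · have hc := φ.2.1.isStarCover hT.1 h3 h₀ (φ.2.1.ne_of_adj hT.1 h3 φ.2.2 h₀)
    exact hc.aut_ext hT.1 (γ := γ) (δ := 1) ((mem_stabilizer_aut_iff φ γ).1 hγ) hx
  · rintro x y hxy ⟨h, -⟩
    have h1 := (mem_stabilizer_aut_iff φ γ).1 hγ x
    rw [h] at h1
    exact φ.2.1.ne_of_adj hT.1 h3 φ.2.2 hxy h1.symm
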